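/- \textbf{Model.} A sensor sends update packets $k=1,2,\dots$ through a channel with i.i.d. transmission delays $D_k\ge 0$ of law $\mathbb P$. Packet $k$ is sampled at time $S_k$ and received at $R_k=S_k+D_k$, with $S_1=0$ and $S_{k+1}=R_k+W_k$, where $W_k\in[0,W_{\mathsf{ub}}]$, $W_{\mathsf{ub}}>0$, is the waiting time. A causal policy $\pi\in\Pi$ chooses $W_k$ as a measurable function of $D_1,\dots,D_k$ and possibly of an independent random seed. At time $0$ the receiver holds a packet (index $0$) of age $a_0\ge 0$, so that $S_0=-a_0$ and $R_0=0$. The age of information is $A(t)=t-S_{i(t)}$, where $i(t)=\max\{k: R_k\le t\}$. There is no sampling frequency constraint. The minimum average age is $$\overline A_{\pi^\star_{\mathbb P}}=\inf_{\pi\in\Pi}\limsup_{K\to\infty}\frac{\mathbb E\left[\int_0^{S_{K+1}}A(t)\,dt\right]}{\mathbb E[S_{K+1}]},$$ and $\gamma^\star_{\mathbb P}=\overline A_{\pi^\star_{\mathbb P}}-\mathbb E_{\mathbb P}[D]$ is the optimal threshold. \textbf{Theorem 4.} (i) Let $0<\overline D_{\mathsf{lb}}\le\overline D_{\mathsf{ub}}$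 and $0<M_{\mathsf{lb}}\le M_{\mathsf{ub}}$ with $\overline D_{\mathsf{lb}}^2<M_{\mathsf{ub}}$, and let $\mathcal P$ be the set of absolutely continuous laws $\mathbb P$ on $[0,\infty)$ with $\overline D_{\mathsf{lb}}\le\mathbb E_{\mathbb P}[D]\le\overline D_{\mathsf{ub}}$ and $M_{\mathsf{lb}}\le\mathbb E_{\mathbb P}[D^2]\le M_{\mathsf{ub}}$. There is a constant $c>0$, depending only on $\overline D_{\mathsf{lb}},\overline D_{\mathsf{ub}},M_{\mathsf{lb}},M_{\mathsf{ub}},W_{\mathsf{ub}}$, such that for every $k\ge1$ $$\inf_{\hat\gamma}\sup_{\mathbb P\in\mathcal P}\mathbb E_{\mathbb P}\left[\left(\hat\gamma(D_1,\dots,D_k)-\gamma^\star_{\mathbb P}\right)^2\right]\ge\frac ck,$$ where $\hat\gamma$ ranges over all measurable functions $\mathbb R^k\to\mathbb R$. (ii) Let $B>0$. For $0<\delta<\frac12\left(\sqrt[3]{\tfrac12+\sqrt{\tfrac54}}+\sqrt[3]{\tfrac12-\sqrt{\tfrac54}}\right)$ let $\mathcal P_w(\delta)$ be the set of absolutely continuous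 laws on $[0,B]$ for which the optimal policy waits with probability at least $\delta$, i.e. $\Pr_{D\sim\mathbb P}(D\le\gamma^\star_{\mathbb P})\ge\delta$. There are a constant $c>0$ and an integer $K_0$, depending only on $B$ and $W_{\mathsf{ub}}$, such that for all such $\delta$ and all $K\ge K_0$ $$\inf_{\pi\in\Pi}\ \sup_{\mathbb P\in\mathcal P_w(\delta)}\left(\frac{\mathbb E\left[\int_0^{S_{K+1}}A(t)\,dt\right]}{\mathbb E[S_{K+1}]}-\overline A_{\pi^\star_{\mathbb P}}\right)\ \ge\ \delta\cdot c\,\frac{\ln K}{K}.$$ -/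

import Mathlib

open MeasureTheory ProbabilityTheory Filter Topology
open scoped ENNReal unitInterval

noncomputable section

/-- A causal (possibly randomized) sampling policy with waiting times in `[0, Wub]`.
`wait k u (D₁, …, D_k)` is the waiting time `W_k` chosen after the `k`-th packet has been received,
where `u` is a seed drawn uniformly from `[0, 1]`, independently of the delays (a policy that
ignores `u` is deterministic). The earlier sampling times are functions of `u` and of the earlier
delays, so they need no separate mention. -/
structure CausalPolicy (Wub : ℝ) where
  wait : (k : ℕ) → I → (Fin k → ℝ) → ℝ
  measurable_wait : ∀ k, Measurable (fun p : I × (Fin k → ℝ) => wait k p.1 p.2)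
  wait_nonneg : ∀ k u h, 0 ≤ wait k u h
  wait_le : ∀ k u h, wait k u h ≤ Wub

namespace CausalPolicy

variable {Wub : ℝ}

/-- The waiting time `W_k` along the delay sequence `d`, where `d i` is the delay `D_{i+1}`. -/
def waitingTime (π : CausalPolicy Wub) (u : I) (d : ℕ → ℝ) (k : ℕ) : ℝ :=
  π.wait k u (fun i : Fin k => d i)

/-- The sampling time `S_k`. Packet `0` is the one that the receiver holds at time `0`; it was
generated at time `-a₀`. The first packet is sampled at time `0`, and
`S_{k+1} = S_k + D_k + W_k` for `k ≥ 1`. -/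
def sampleTime (a₀ : ℝ) (π : CausalPolicy Wub) (u : I) (d : ℕ → ℝ) : ℕ → ℝ
  | 0 => -a₀
  | 1 => 0
  | (k + 2) => sampleTime a₀ π u d (k + 1) + d k + π.waitingTime u d (k + 1)

/-- The reception time `R_k = S_k + D_k`; packet `0` is there at time `0`. -/
def receptionTime (a₀ : ℝ) (π : CausalPolicy Wub) (u : I) (d : ℕ → ℝ) : ℕ → ℝ
  | 0 => 0
  | (k + 1) => π.sampleTime a₀ u d (k + 1) + d k

/-- The index `i(t)` of the latest packet received by time `t`. -/
def latestIndex (a₀ : ℝ) (π : CausalPolicy Wub) (u : I) (d : ℕ → ℝ) (t : ℝ) : ℕ :=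
  sSup {k : ℕ | π.receptionTime a₀ u d k ≤ t}

/-- The age of information `A(t) = t - S_{i(t)}`. -/
def age (a₀ : ℝ) (π : CausalPolicy Wub) (u : I) (d : ℕ → ℝ) (t : ℝ) : ℝ :=
  t - π.sampleTime a₀ u d (π.latestIndex a₀ u d t)

end CausalPolicy

/-- The law of the seed together with the i.i.d. sequence of delays with law `P`. -/
def seedDelayLaw (P : ProbabilityMeasure ℝ) : Measure (I × (ℕ → ℝ)) :=
  (volume : Measure I).prod (Measure.infinitePi (fun _ : ℕ => (P : Measure ℝ)))

/-- The ratio `E[∫_0^{S_{K+1}} A(t) dt] / E[S_{K+1}]` for the policy `π` and the delay law `P`. -/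
def aoiRatio (a₀ : ℝ) {Wub : ℝ} (π : CausalPolicy Wub) (P : ProbabilityMeasure ℝ) (K : ℕ) : ℝ :=
  (∫ ω, (∫ t in (0 : ℝ)..(π.sampleTime a₀ ω.1 ω.2 (K + 1)), π.age a₀ ω.1 ω.2 t)
      ∂(seedDelayLaw P)) /
    (∫ ω, π.sampleTime a₀ ω.1 ω.2 (K + 1) ∂(seedDelayLaw P))

/-- The long-run average age of information of the policy `π` under the delay law `P`. -/
def averageAoI (a₀ : ℝ) {Wub : ℝ} (π : CausalPolicy Wub) (P : ProbabilityMeasure ℝ) : ℝ :=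
  limsup (fun K : ℕ => aoiRatio a₀ π P K) atTop

/-- The minimum long-run average age of information over all causal policies. -/
def optimalAoI (a₀ Wub : ℝ) (P : ProbabilityMeasure ℝ) : ℝ :=
  ⨅ π : CausalPolicy Wub, averageAoI a₀ π P

/-- The optimal threshold: the minimum average age minus the mean delay. -/
def optimalThreshold (a₀ Wub : ℝ) (P : ProbabilityMeasure ℝ) : ℝ :=
  optimalAoI a₀ Wub P - ∫ x, x ∂(P : Measure ℝ)

/-- Absolutely continuous delay laws on `[0, ∞)` with mean in `[Dlb, Dub]` and second moment in
`[Mlb, Mub]`. -/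
def momentClass (Dlb Dub Mlb Mub : ℝ) : Set (ProbabilityMeasure ℝ) :=
  {P | (P : Measure ℝ) ≪ volume ∧ (∀ᵐ x ∂(P : Measure ℝ), 0 ≤ x) ∧
    Integrable (fun x : ℝ => x ^ 2) (P : Measure ℝ) ∧
    (∫ x, x ∂(P : Measure ℝ)) ∈ Set.Icc Dlb Dub ∧
    (∫ x, x ^ 2 ∂(P : Measure ℝ)) ∈ Set.Icc Mlb Mub}

/-- Absolutely continuous delay laws on `[0, B]` for which the optimal policy waits with
probability at least `δ`. -/
def waitingClass (a₀ Wub B δ : ℝ) : Set (ProbabilityMeasure ℝ) :=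
  {P | (P : Measure ℝ) ≪ volume ∧ (∀ᵐ x ∂(P : Measure ℝ), 0 ≤ x ∧ x ≤ B) ∧
    δ ≤ (P : Measure ℝ).real {x | x ≤ optimalThreshold a₀ Wub P}}

end

/-! Both bounds rest on describing the optimal threshold as the root of a functional that is affine
under tilts of the delay law. The area under the age curve splits over sampling cycles
(`integral_age`), and each delay is independent of the cycle before it. Hence, for any price γ, the
average age is the mean delay m plus γ, plus the total expected value of L²/2 - γL and a bounded
boundary term, divided by the expected horizon (`aoiRatio_eq`). Given a delay d, the cycle length L
ranges over [d, d + Wub], so the best choice is the projection of γ onto that interval. The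
resulting expected minimum `expMinLagrangian` decreases in γ with slopes between -(m + Wub) and -m;
its root is the optimal threshold (`optimalThreshold_eq`).

Tilting a law by the density 1 + θs moves the root at a rate proportional to θ
(`IsDelayLaw.root_gap`), whereas n samples do not separate parameters θ ± ε with ε of order n^(-1/2)
(`IsScore.two_point`). For estimation, a gamma law is tilted along a score orthogonal to 1, x and
x², so the tilts stay in the moment class; the kink of the least Lagrangian at γ still makes the
root move (`exists_score`). The squared error is then at least of order 1/k.

For the regret, the base law lives on a band of short and a band of long delays, with all thresholds
between them. After a short delay the excess Lagrangian is exactly (L - γ)²/2, so the cycle length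
acts as an estimator of the threshold from the delays seen so far, and its error in cycle i is of
order 1/i. The worst parameter may depend on i. Averaging over one fixed prior on θ makes the errors
add up, and the harmonic sum gives the logarithm (`log_le_of_sum_lagrangian_le`). Dividing by the
horizon, which is at most linear in K, gives the rate ln K / K. -/

namespace CausalPolicy

/-! ### Pathwise area under the age curve. -/

variable {Wub : ℝ} (π : CausalPolicy Wub) (a₀ : ℝ) (u : I) (d : ℕ → ℝ)

/-- The time `L_{k+1} = D_{k+1} + W_{k+1}` between the sampling of two consecutive packets. -/
noncomputable def cycle (k : ℕ) : ℝ := d k + π.waitingTime u d (k + 1)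

lemma sampleTime_succ_succ (k : ℕ) :
    π.sampleTime a₀ u d (k + 2) = π.sampleTime a₀ u d (k + 1) + π.cycle u d k := by
  rw [sampleTime, cycle, add_assoc]

lemma sampleTime_succ_eq_sum (k : ℕ) :
    π.sampleTime a₀ u d (k + 1) = ∑ i ∈ Finset.range k, π.cycle u d i := by
  induction k with
  | zero => rfl
  | succ k ih => rw [sampleTime_succ_succ, ih, Finset.sum_range_succ]

lemma sampleTime_le_receptionTime (hd : ∀ i, 0 ≤ d i) (k : ℕ) :
    π.sampleTime a₀ u d (k + 1) ≤ π.receptionTime a₀ u d (k + 1) := by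
  rw [receptionTime]; linarith [hd k]

lemma receptionTime_le_sampleTime (k : ℕ) :
    π.receptionTime a₀ u d k ≤ π.sampleTime a₀ u d (k + 1) := by
  cases k with
  | zero => rfl
  | succ k =>
    rw [receptionTime, sampleTime_succ_succ, cycle]
    linarith [π.wait_nonneg (k + 1) u (fun i : Fin (k + 1) => d i),
      show π.waitingTime u d (k + 1) = π.wait (k + 1) u (fun i : Fin (k + 1) => d i) from rfl]

lemma monotone_receptionTime (hd : ∀ i, 0 ≤ d i) : Monotone (π.receptionTime a₀ u d) :=
  monotone_nat_of_le_succ fun k =>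
    (π.receptionTime_le_sampleTime a₀ u d k).trans (π.sampleTime_le_receptionTime a₀ u d hd k)

lemma latestIndex_eq (hd : ∀ i, 0 ≤ d i) {k : ℕ} {t : ℝ}
    (h1 : π.receptionTime a₀ u d k ≤ t) (h2 : t < π.receptionTime a₀ u d (k + 1)) :
    π.latestIndex a₀ u d t = k := by
  refine IsGreatest.csSup_eq ⟨h1, fun j hj => ?_⟩
  by_contra! hlt
  exact absurd (h2.trans_le (π.monotone_receptionTime a₀ u d hd hlt)) (not_lt.2 hj)

lemma cycle_nonneg (hd : ∀ i, 0 ≤ d i) (k : ℕ) : 0 ≤ π.cycle u d k :=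
  add_nonneg (hd k) (π.wait_nonneg _ _ _)

/-- The area under the age curve, as a sum over the sampling cycles. -/
lemma integral_age (hd : ∀ i, 0 ≤ d i) (K : ℕ) :
    IntervalIntegrable (π.age a₀ u d) volume 0 (π.sampleTime a₀ u d (K + 1)) ∧
    ∫ t in (0 : ℝ)..(π.sampleTime a₀ u d (K + 1)), π.age a₀ u d t =
      ∑ i ∈ Finset.range K,
        ((π.sampleTime a₀ u d (i + 1) - π.sampleTime a₀ u d i) * d i
          + π.cycle u d i ^ 2 / 2) := by
  induction K with
  | zero =>
    have h0 : π.sampleTime a₀ u d (0 + 1) = 0 := rfl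
    simp [h0]
  | succ K ih =>
    set S := π.sampleTime a₀ u d with hS
    set R := π.receptionTime a₀ u d with hR
    have hSR : S (K + 1) ≤ R (K + 1) := π.sampleTime_le_receptionTime a₀ u d hd K
    have hRS : R (K + 1) ≤ S (K + 2) := π.receptionTime_le_sampleTime a₀ u d (K + 1)
    have hRK : R K ≤ S (K + 1) := π.receptionTime_le_sampleTime a₀ u d K
    have hSR2 : S (K + 2) ≤ R (K + 2) := π.sampleTime_le_receptionTime a₀ u d hd (K + 1)
    -- While packet K + 1 is in transit the age still refers to packet K; after its reception it
    -- refers to packet K + 1. The extra age S (K + 1) - S K during transmission is the source of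
    -- the product term in the sum.
    have e1 : Set.EqOn (fun t => t - S K) (π.age a₀ u d) (Set.Ioo (S (K + 1)) (R (K + 1))) := by
      intro t ht
      simp only [age]
      rw [π.latestIndex_eq a₀ u d hd (k := K) (hRK.trans ht.1.le) ht.2]
    have e2 : Set.EqOn (fun t => t - S (K + 1)) (π.age a₀ u d)
        (Set.Ioo (R (K + 1)) (S (K + 2))) := by
      intro t ht
      simp only [age]
      rw [π.latestIndex_eq a₀ u d hd (k := K + 1) ht.1.le (ht.2.trans_le hSR2)]
    have i1 : IntervalIntegrable (π.age a₀ u d) volume (S (K + 1)) (R (K + 1)) :=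
      (((by fun_prop : Continuous fun t : ℝ => t - S K)).intervalIntegrable _ _).congr_uIoo
        (by rwa [Set.uIoo_of_le hSR])
    have i2 : IntervalIntegrable (π.age a₀ u d) volume (R (K + 1)) (S (K + 2)) :=
      (((by fun_prop : Continuous fun t : ℝ => t - S (K + 1))).intervalIntegrable _ _).congr_uIoo
        (by rwa [Set.uIoo_of_le hRS])
    refine ⟨(ih.1.trans i1).trans i2, ?_⟩
    rw [Finset.sum_range_succ, ← ih.2, ← intervalIntegral.integral_add_adjacent_intervals
      (ih.1.trans i1) i2, ← intervalIntegral.integral_add_adjacent_intervals ih.1 i1,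
      ← intervalIntegral.integral_congr_Ioo_of_le hSR e1,
      ← intervalIntegral.integral_congr_Ioo_of_le hRS e2,
      intervalIntegral.integral_sub (by simp) (by simp),
      intervalIntegral.integral_sub (by simp) (by simp)]
    simp only [integral_id, intervalIntegral.integral_const, smul_eq_mul]
    have hR1 : R (K + 1) = S (K + 1) + d K := rfl
    have hS2 : S (K + 2) = S (K + 1) + π.cycle u d K := π.sampleTime_succ_succ a₀ u d K
    rw [hR1, hS2]
    ring

end CausalPolicy

/-! ### Pointwise minimization of the Lagrangian. -/

/-- The Lagrangian `L² / 2 - γ L` of a cycle of length `L` at the age price `γ`. -/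
noncomputable def lagrangian (γ L : ℝ) : ℝ := L ^ 2 / 2 - γ * L

/-- The cycle length of the threshold policy: wait until the cycle has length `γ`, subject to the
constraint that the waiting time lies in `[0, Wub]`. -/
noncomputable def thresholdCycle (Wub γ d : ℝ) : ℝ := d + max 0 (min (γ - d) Wub)

/-- The least Lagrangian of a cycle that starts with the delay `d`. -/
noncomputable def minLagrangian (Wub γ d : ℝ) : ℝ := lagrangian γ (thresholdCycle Wub γ d)

lemma le_thresholdCycle (Wub γ d : ℝ) : d ≤ thresholdCycle Wub γ d := by
  rw [thresholdCycle]; linarith [le_max_left 0 (min (γ - d) Wub)]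

lemma thresholdCycle_le {Wub : ℝ} (hW : 0 ≤ Wub) (γ d : ℝ) :
    thresholdCycle Wub γ d ≤ d + Wub := by
  rw [thresholdCycle]; linarith [max_le hW (min_le_right (γ - d) Wub)]

/-- The Lagrangian is (L - γ)²/2 up to a constant, and `thresholdCycle` is the projection of γ onto
the interval of admissible L. -/
lemma minLagrangian_le {Wub : ℝ} (γ : ℝ) {d L : ℝ} (h1 : d ≤ L) (h2 : L ≤ d + Wub) :
    minLagrangian Wub γ d ≤ lagrangian γ L := by
  rw [minLagrangian, lagrangian, lagrangian]
  have key : (thresholdCycle Wub γ d - γ) ^ 2 ≤ (L - γ) ^ 2 := by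
    rw [thresholdCycle]
    rcases le_total (γ - d) 0 with h | h
    · rw [max_eq_left ((min_le_left _ _).trans h)]
      nlinarith
    · rcases le_total (γ - d) Wub with h' | h'
      · rw [min_eq_left h', max_eq_right h]
        nlinarith [sq_nonneg (L - γ)]
      · rw [min_eq_right h', max_eq_right (by linarith)]
        nlinarith
  nlinarith

lemma minLagrangian_of_le {Wub γ d : ℝ} (h : γ ≤ d) :
    minLagrangian Wub γ d = lagrangian γ d := by
  rw [minLagrangian, thresholdCycle,
    max_eq_left ((min_le_left (γ - d) Wub).trans (sub_nonpos.2 h)), add_zero]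

lemma minLagrangian_of_ge {Wub γ d : ℝ} (h : d ≤ γ) (h' : γ ≤ d + Wub) :
    minLagrangian Wub γ d = -(γ ^ 2 / 2) := by
  rw [minLagrangian, thresholdCycle, min_eq_left (by linarith), max_eq_right (by linarith),
    lagrangian]
  ring

lemma neg_sq_le_minLagrangian (Wub γ d : ℝ) : -(γ ^ 2 / 2) ≤ minLagrangian Wub γ d := by
  rw [minLagrangian, lagrangian]
  nlinarith [sq_nonneg (thresholdCycle Wub γ d - γ)]

lemma continuous_minLagrangian (Wub γ : ℝ) : Continuous (minLagrangian Wub γ) := by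
  unfold minLagrangian lagrangian thresholdCycle
  fun_prop

/-- Envelope argument: the cycle that is optimal at one price is admissible at the other, and its
length is at least d. The companion bound below uses length at most d + Wub instead. -/
lemma minLagrangian_add_le {Wub : ℝ} (hW : 0 ≤ Wub) {γ γ' : ℝ} (h : γ ≤ γ') (d : ℝ) :
    minLagrangian Wub γ' d + (γ' - γ) * d ≤ minLagrangian Wub γ d := by
  have h1 := minLagrangian_le γ' (le_thresholdCycle Wub γ d) (thresholdCycle_le hW γ d)
  have h2 := mul_le_mul_of_nonneg_left (le_thresholdCycle Wub γ d) (sub_nonneg.2 h)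
  rw [lagrangian] at h1
  rw [minLagrangian.eq_def Wub γ d, lagrangian]
  linarith

lemma minLagrangian_le_add {Wub : ℝ} (hW : 0 ≤ Wub) {γ γ' : ℝ} (h : γ ≤ γ') (d : ℝ) :
    minLagrangian Wub γ d ≤ minLagrangian Wub γ' d + (γ' - γ) * (d + Wub) := by
  have h1 := minLagrangian_le γ (le_thresholdCycle Wub γ' d) (thresholdCycle_le hW γ' d)
  have h2 := mul_le_mul_of_nonneg_left (thresholdCycle_le hW γ' d) (sub_nonneg.2 h)
  rw [lagrangian] at h1
  rw [minLagrangian.eq_def Wub γ' d, lagrangian]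
  linarith

/-! ### Delay laws and the root of the expected least Lagrangian. -/

/-- A law of nonnegative delays with positive mean and finite second moment. -/
structure IsDelayLaw (P : Measure ℝ) : Prop where
  nonneg : ∀ᵐ x ∂P, 0 ≤ x
  integrable_sq : Integrable (fun x : ℝ => x ^ 2) P
  mean_pos : 0 < ∫ x, x ∂P

lemma IsDelayLaw.memLp {P : Measure ℝ} (hP : IsDelayLaw P) : MemLp (fun x : ℝ => x) 2 P :=
  (memLp_two_iff_integrable_sq measurable_id.aestronglyMeasurable).2 hP.integrable_sq

section DelayLaw

variable {P : Measure ℝ} [IsProbabilityMeasure P] {Wub : ℝ}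

lemma IsDelayLaw.integrable (hP : IsDelayLaw P) : Integrable (fun x : ℝ => x) P :=
  hP.memLp.integrable one_le_two

lemma IsDelayLaw.integrable_minLagrangian (hP : IsDelayLaw P) (hW : 0 ≤ Wub) (γ : ℝ) :
    Integrable (minLagrangian Wub γ) P := by
  refine ((hP.integrable_sq.add (hP.integrable.norm.const_mul |γ|)).add
    (integrable_const (γ ^ 2 / 2))).mono'
    (continuous_minLagrangian Wub γ).aestronglyMeasurable (ae_of_all _ fun d => ?_)
  have h1 := minLagrangian_le (Wub := Wub) γ (le_refl d) (by linarith)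
  have h2 := neg_sq_le_minLagrangian Wub γ d
  rw [lagrangian] at h1
  have h3 : -(γ * d) ≤ |γ| * |d| := by rw [← abs_mul]; exact neg_le_abs _
  simp only [Pi.add_apply, Real.norm_eq_abs]
  rw [abs_le]
  constructor <;> nlinarith [sq_nonneg d, sq_nonneg γ, mul_nonneg (abs_nonneg γ) (abs_nonneg d)]

/-- The expected least Lagrangian per cycle at the price `γ`. -/
noncomputable def expMinLagrangian (Wub : ℝ) (P : Measure ℝ) (γ : ℝ) : ℝ :=
  ∫ d, minLagrangian Wub γ d ∂P

lemma IsDelayLaw.expMinLagrangian_add_le (hP : IsDelayLaw P) (hW : 0 ≤ Wub) {γ γ' : ℝ}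
    (h : γ ≤ γ') :
    expMinLagrangian Wub P γ' + (γ' - γ) * ∫ x, x ∂P ≤ expMinLagrangian Wub P γ := by
  rw [expMinLagrangian, expMinLagrangian, ← integral_const_mul,
    ← integral_add (hP.integrable_minLagrangian hW _) (hP.integrable.const_mul _)]
  exact integral_mono ((hP.integrable_minLagrangian hW _).add (hP.integrable.const_mul _))
    (hP.integrable_minLagrangian hW _) (minLagrangian_add_le hW h)

lemma IsDelayLaw.expMinLagrangian_le_add (hP : IsDelayLaw P) (hW : 0 ≤ Wub) {γ γ' : ℝ}
    (h : γ ≤ γ') :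
    expMinLagrangian Wub P γ ≤
      expMinLagrangian Wub P γ' + (γ' - γ) * ((∫ x, x ∂P) + Wub) := by
  have e : (∫ x, x ∂P) + Wub = ∫ x, (x + Wub) ∂P := by
    rw [integral_add hP.integrable (integrable_const _)]; simp
  have i : Integrable (fun x => (γ' - γ) * (x + Wub)) P :=
    (hP.integrable.add (integrable_const Wub)).const_mul (γ' - γ)
  rw [expMinLagrangian, expMinLagrangian, e, ← integral_const_mul,
    ← integral_add (hP.integrable_minLagrangian hW _) i]
  exact integral_mono (hP.integrable_minLagrangian hW _)
    ((hP.integrable_minLagrangian hW _).add i) (minLagrangian_le_add hW h)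

lemma IsDelayLaw.strictAnti_expMinLagrangian (hP : IsDelayLaw P) (hW : 0 ≤ Wub) :
    StrictAnti (expMinLagrangian Wub P) := fun γ γ' h => by
  nlinarith [hP.expMinLagrangian_add_le hW h.le, mul_pos (sub_pos.2 h) hP.mean_pos]

lemma IsDelayLaw.continuous_expMinLagrangian (hP : IsDelayLaw P) (hW : 0 ≤ Wub) :
    Continuous (expMinLagrangian Wub P) := by
  refine LipschitzWith.continuous (K := ((∫ x, x ∂P) + Wub).toNNReal)
    (LipschitzWith.of_dist_le_mul fun γ γ' => ?_)
  have hm := hP.mean_pos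
  rw [Real.coe_toNNReal _ (by linarith)]
  wlog h : γ ≤ γ' generalizing γ γ'
  · rw [dist_comm, dist_comm γ]; exact this γ' γ (le_of_not_ge h)
  rw [dist_comm, dist_comm γ, Real.dist_eq, Real.dist_eq, abs_of_nonneg (sub_nonneg.2 h),
    abs_of_nonpos (sub_nonpos.2 ((hP.strictAnti_expMinLagrangian hW).antitone h))]
  linarith [hP.expMinLagrangian_le_add hW h]

/-- The price at which the expected least Lagrangian vanishes. -/
lemma IsDelayLaw.exists_expMinLagrangian_eq_zero (hP : IsDelayLaw P) (hW : 0 ≤ Wub) :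
    ∃ γ, 0 < γ ∧ expMinLagrangian Wub P γ = 0 := by
  have hm := hP.mean_pos
  set m := ∫ x, x ∂P
  have hpos : 0 < ∫ x, x ^ 2 ∂P := by
    refine lt_of_lt_of_le (by positivity) (b := m ^ 2) ?_
    have h0 : 0 ≤ ∫ x, (x - m) ^ 2 ∂P := integral_nonneg fun x => sq_nonneg _
    have h1 : ∫ x, (x - m) ^ 2 ∂P = (∫ x, x ^ 2 ∂P) - m ^ 2 := by
      have : (fun x : ℝ => (x - m) ^ 2) = fun x => x ^ 2 - 2 * m * x + m ^ 2 := by ext; ring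
      have i : Integrable (fun x => x ^ 2 - 2 * m * x) P :=
        hP.integrable_sq.sub (hP.integrable.const_mul _)
      rw [this, integral_add i (integrable_const _), integral_sub hP.integrable_sq (hP.integrable.const_mul _),
        integral_const_mul]
      simp only [integral_const, probReal_univ, one_smul]
      change _ - 2 * m * m + _ = _
      ring
    linarith
  have h0 : 0 < expMinLagrangian Wub P 0 := by
    have : expMinLagrangian Wub P 0 = (∫ x, x ^ 2 ∂P) / 2 := by
      rw [expMinLagrangian, ← integral_div]
      refine integral_congr_ae (hP.nonneg.mono fun x hx => ?_)
      simp only [minLagrangian_of_le hx, lagrangian]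
      ring
    rw [this]; positivity
  -- The price at which never waiting has zero expected Lagrangian, so the minimum there is
  -- nonpositive.
  set γ₁ := (∫ x, x ^ 2 ∂P) / (2 * m) with hγ₁
  have h1 : expMinLagrangian Wub P γ₁ ≤ 0 := by
    calc expMinLagrangian Wub P γ₁ ≤ ∫ x, (x ^ 2 / 2 - γ₁ * x) ∂P :=
          integral_mono (hP.integrable_minLagrangian hW _)
            ((hP.integrable_sq.div_const 2).sub (hP.integrable.const_mul _))
            fun x => minLagrangian_le γ₁ le_rfl (by linarith)
      _ = 0 := by
          rw [integral_sub (hP.integrable_sq.div_const 2) (hP.integrable.const_mul _),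
            integral_div, integral_const_mul, hγ₁]
          change _ - _ * m = 0
          field_simp
          ring
  obtain ⟨γ, hγ, hz⟩ := intermediate_value_Icc' (by positivity : (0 : ℝ) ≤ γ₁)
    (hP.continuous_expMinLagrangian hW).continuousOn ⟨h1, h0.le⟩
  refine ⟨γ, hγ.1.lt_of_ne ?_, hz⟩
  rintro rfl
  exact h0.ne' hz

end DelayLaw

/-! ### Independence of delays and the ratio formula. -/

section SeedDelayLaw

instance isProbabilityMeasure_seedDelayLaw (P : ProbabilityMeasure ℝ) :
    IsProbabilityMeasure (seedDelayLaw P) := by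
  unfold seedDelayLaw; infer_instance

variable (P : ProbabilityMeasure ℝ)

lemma measurePreserving_delay (i : ℕ) :
    MeasurePreserving (fun ω : I × (ℕ → ℝ) => ω.2 i) (seedDelayLaw P) (P : Measure ℝ) :=
  (measurePreserving_eval_infinitePi (fun _ : ℕ => (P : Measure ℝ)) i).comp measurePreserving_snd

/-- The law of the seed and the first `n` delays. -/
lemma measurePreserving_history (n : ℕ) :
    MeasurePreserving (fun ω : I × (ℕ → ℝ) => (ω.1, fun i : Fin n => ω.2 i)) (seedDelayLaw P)
      ((volume : Measure I).prod (Measure.pi fun _ : Fin n => (P : Measure ℝ))) := by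
  have h : MeasurePreserving (fun (d : ℕ → ℝ) (i : Fin n) => d i)
      (Measure.infinitePi fun _ : ℕ => (P : Measure ℝ))
      (Measure.pi fun _ : Fin n => (P : Measure ℝ)) := by
    refine ⟨by fun_prop, ?_⟩
    rw [Measure.map_infinitePi_infinitePi_of_inj (f := fun i : Fin n => (i : ℕ))
      Fin.val_injective, Measure.infinitePi_eq_pi]
  exact (MeasurePreserving.id _).prod h

/-- The delay of a packet is independent of the seed and the earlier delays. -/
lemma measurePreserving_history_delay (n : ℕ) :
    MeasurePreserving (fun ω : I × (ℕ → ℝ) => ((ω.1, fun i : Fin n => ω.2 i), ω.2 n))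
      (seedDelayLaw P)
      (((volume : Measure I).prod (Measure.pi fun _ : Fin n => (P : Measure ℝ))).prod
        (P : Measure ℝ)) := by
  have h1 := measurePreserving_history P (n + 1)
  have h2 := (MeasurePreserving.id (volume : Measure I)).prod
    ((Measure.measurePreserving_swap (μ := (P : Measure ℝ))
      (ν := Measure.pi fun _ : Fin n => (P : Measure ℝ))).comp
    (measurePreserving_piFinSuccAbove (fun _ : Fin (n + 1) => (P : Measure ℝ)) (Fin.last n)))
  have h3 := (measurePreserving_prodAssoc (volume : Measure I)
    (Measure.pi fun _ : Fin n => (P : Measure ℝ)) (P : Measure ℝ)).symm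
  have h := h3.comp (h2.comp h1)
  convert h using 1
  ext ω
  · rfl
  · simp [MeasurableEquiv.piFinSuccAbove, Fin.insertNthEquiv, MeasurableEquiv.prodAssoc, Fin.init]
  · simp [MeasurableEquiv.piFinSuccAbove, Fin.insertNthEquiv, MeasurableEquiv.prodAssoc]

lemma integral_history_mul_delay {n : ℕ} {X : I × (Fin n → ℝ) → ℝ} (hX : Measurable X) :
    ∫ ω, X (ω.1, fun i : Fin n => ω.2 i) * ω.2 n ∂(seedDelayLaw P) =
      (∫ ω, X (ω.1, fun i : Fin n => ω.2 i) ∂(seedDelayLaw P)) * ∫ x, x ∂(P : Measure ℝ) := by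
  have h := measurePreserving_history_delay P n
  have e1 := integral_map (μ := seedDelayLaw P) h.aemeasurable
    (f := fun z : (I × (Fin n → ℝ)) × ℝ => X z.1 * z.2)
    (by fun_prop : Measurable _).aestronglyMeasurable
  -- The factor 1 integrates out the last delay, so both sides are computed under the same product
  -- law.
  have e2 := integral_map (μ := seedDelayLaw P) h.aemeasurable
    (f := fun z : (I × (Fin n → ℝ)) × ℝ => X z.1 * 1)
    (by fun_prop : Measurable _).aestronglyMeasurable
  rw [h.map_eq] at e1 e2
  rw [integral_prod_mul (f := X) (g := fun x => x)] at e1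
  rw [integral_prod_mul (f := X) (g := fun _ => (1 : ℝ))] at e2
  simp only [mul_one, integral_const, probReal_univ, smul_eq_mul] at e2
  rw [← e1, e2]

lemma ae_delay_nonneg (hP : IsDelayLaw (P : Measure ℝ)) :
    ∀ᵐ ω ∂(seedDelayLaw P), ∀ i, 0 ≤ ω.2 i :=
  ae_all_iff.2 fun i => (measurePreserving_delay P i).quasiMeasurePreserving.ae hP.nonneg

namespace CausalPolicy

variable {Wub : ℝ} (π : CausalPolicy Wub)

/-- The cycle length as a function of the seed and the delays up to that of the cycle. -/
noncomputable def cycleOfHistory (k : ℕ) (z : I × (Fin (k + 1) → ℝ)) : ℝ :=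
  z.2 (Fin.last k) + π.wait (k + 1) z.1 z.2

lemma measurable_cycleOfHistory (k : ℕ) : Measurable (π.cycleOfHistory k) :=
  ((measurable_pi_apply _).comp measurable_snd).add (π.measurable_wait (k + 1))

lemma measurable_cycle (k : ℕ) : Measurable fun ω : I × (ℕ → ℝ) => π.cycle ω.1 ω.2 k :=
  (π.measurable_cycleOfHistory k).comp
    (by fun_prop : Measurable fun ω : I × (ℕ → ℝ) => (ω.1, fun i : Fin (k + 1) => ω.2 i))

lemma le_cycle (u : I) (d : ℕ → ℝ) (k : ℕ) : d k ≤ π.cycle u d k :=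
  le_add_of_nonneg_right (π.wait_nonneg _ _ _)

lemma cycle_le (u : I) (d : ℕ → ℝ) (k : ℕ) : π.cycle u d k ≤ d k + Wub :=
  add_le_add_right (π.wait_le _ _ _) _

lemma integral_delay (P : ProbabilityMeasure ℝ) (k : ℕ) :
    ∫ ω : I × (ℕ → ℝ), ω.2 k ∂(seedDelayLaw P) = ∫ x, x ∂(P : Measure ℝ) := by
  have h := measurePreserving_delay P k
  rw [← h.map_eq, integral_map h.aemeasurable measurable_id'.aestronglyMeasurable]

variable {P} (hP : IsDelayLaw (P : Measure ℝ))
include hP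

lemma memLp_delay (k : ℕ) :
    MemLp (fun ω : I × (ℕ → ℝ) => ω.2 k) 2 (seedDelayLaw P) :=
  hP.memLp.comp_measurePreserving (measurePreserving_delay P k)

lemma memLp_cycle (k : ℕ) :
    MemLp (fun ω : I × (ℕ → ℝ) => π.cycle ω.1 ω.2 k) 2 (seedDelayLaw P) := by
  refine MemLp.of_le ((memLp_delay hP k).add (memLp_const Wub))
    (π.measurable_cycle k).aestronglyMeasurable ((ae_delay_nonneg P hP).mono fun ω hω => ?_)
  rw [Real.norm_of_nonneg (π.cycle_nonneg _ _ hω k)]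
  exact (π.cycle_le ω.1 ω.2 k).trans (le_abs_self _)

lemma integrable_cycle (k : ℕ) :
    Integrable (fun ω : I × (ℕ → ℝ) => π.cycle ω.1 ω.2 k) (seedDelayLaw P) :=
  (π.memLp_cycle hP k).integrable one_le_two

lemma integrable_cycle_sq (k : ℕ) :
    Integrable (fun ω : I × (ℕ → ℝ) => π.cycle ω.1 ω.2 k ^ 2) (seedDelayLaw P) :=
  (π.memLp_cycle hP k).integrable_sq

lemma mean_le_integral_cycle (k : ℕ) :
    ∫ x, x ∂(P : Measure ℝ) ≤ ∫ ω, π.cycle ω.1 ω.2 k ∂(seedDelayLaw P) := by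
  rw [← integral_delay P k]
  exact integral_mono ((memLp_delay hP k).integrable one_le_two) (π.integrable_cycle hP k)
    fun ω => π.le_cycle _ _ _

lemma integral_cycle_le (k : ℕ) :
    ∫ ω, π.cycle ω.1 ω.2 k ∂(seedDelayLaw P) ≤ (∫ x, x ∂(P : Measure ℝ)) + Wub := by
  have h := (memLp_delay hP k).integrable one_le_two
  calc _ ≤ ∫ ω : I × (ℕ → ℝ), (ω.2 k + Wub) ∂(seedDelayLaw P) :=
        integral_mono (π.integrable_cycle hP k) (h.add (integrable_const _))
          fun ω => π.cycle_le _ _ _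
    _ = _ := by rw [integral_add h (integrable_const _), integral_delay P]; simp

lemma integrable_lagrangian_cycle (γ : ℝ) (k : ℕ) :
    Integrable (fun ω : I × (ℕ → ℝ) => lagrangian γ (π.cycle ω.1 ω.2 k)) (seedDelayLaw P) :=
  ((π.integrable_cycle_sq hP k).div_const 2).sub ((π.integrable_cycle hP k).const_mul γ)

lemma integral_lagrangian_cycle (γ : ℝ) (k : ℕ) :
    ∫ ω, lagrangian γ (π.cycle ω.1 ω.2 k) ∂(seedDelayLaw P) =
      (∫ ω, π.cycle ω.1 ω.2 k ^ 2 / 2 ∂(seedDelayLaw P)) -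
        γ * ∫ ω, π.cycle ω.1 ω.2 k ∂(seedDelayLaw P) := by
  rw [← integral_const_mul, ← integral_sub ((π.integrable_cycle_sq hP k).div_const 2)
    ((π.integrable_cycle hP k).const_mul γ)]
  rfl

/-- The expected length of the interval between two sampling times. -/
noncomputable def meanIncrement (P : ProbabilityMeasure ℝ) (a₀ : ℝ) (π : CausalPolicy Wub) :
    ℕ → ℝ
  | 0 => a₀
  | k + 1 => ∫ ω, π.cycle ω.1 ω.2 k ∂(seedDelayLaw P)

lemma integral_increment_mul_delay (a₀ : ℝ) (k : ℕ) :
    Integrable (fun ω : I × (ℕ → ℝ) =>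
      (π.sampleTime a₀ ω.1 ω.2 (k + 1) - π.sampleTime a₀ ω.1 ω.2 k) * ω.2 k) (seedDelayLaw P) ∧
    ∫ ω, (π.sampleTime a₀ ω.1 ω.2 (k + 1) - π.sampleTime a₀ ω.1 ω.2 k) * ω.2 k
      ∂(seedDelayLaw P) = meanIncrement P a₀ π k * ∫ x, x ∂(P : Measure ℝ) := by
  cases k with
  | zero =>
    have e : ∀ ω : I × (ℕ → ℝ),
        π.sampleTime a₀ ω.1 ω.2 (0 + 1) - π.sampleTime a₀ ω.1 ω.2 0 = a₀ := fun ω => by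
      simp [sampleTime]
    simp only [e, meanIncrement, integral_const_mul, integral_delay P, and_true]
    exact ((memLp_delay hP 0).integrable one_le_two).const_mul _
  | succ k =>
    simp only [sampleTime_succ_succ, add_sub_cancel_left, meanIncrement]
    exact ⟨(π.memLp_cycle hP k).integrable_mul (memLp_delay hP (k + 1)),
      integral_history_mul_delay P (π.measurable_cycleOfHistory k)⟩

lemma integral_sampleTime (a₀ : ℝ) (K : ℕ) :
    ∫ ω, π.sampleTime a₀ ω.1 ω.2 (K + 1) ∂(seedDelayLaw P) =
      ∑ i ∈ Finset.range K, ∫ ω, π.cycle ω.1 ω.2 i ∂(seedDelayLaw P) := by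
  simp only [sampleTime_succ_eq_sum]
  exact integral_finsetSum _ fun i _ => π.integrable_cycle hP i

lemma integral_integral_age (a₀ : ℝ) (K : ℕ) :
    ∫ ω, (∫ t in (0 : ℝ)..(π.sampleTime a₀ ω.1 ω.2 (K + 1)), π.age a₀ ω.1 ω.2 t)
      ∂(seedDelayLaw P) =
    ∑ i ∈ Finset.range K, (meanIncrement P a₀ π i * (∫ x, x ∂(P : Measure ℝ)) +
      ∫ ω, π.cycle ω.1 ω.2 i ^ 2 / 2 ∂(seedDelayLaw P)) := by
  rw [integral_congr_ae ((ae_delay_nonneg P hP).mono fun ω hω =>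
    (π.integral_age a₀ ω.1 ω.2 hω K).2), integral_finsetSum]
  · refine Finset.sum_congr rfl fun i _ => ?_
    rw [integral_add (π.integral_increment_mul_delay hP a₀ i).1
      ((π.integrable_cycle_sq hP i).div_const 2), (π.integral_increment_mul_delay hP a₀ i).2]
  · exact fun i _ => (π.integral_increment_mul_delay hP a₀ i).1.add
      ((π.integrable_cycle_sq hP i).div_const 2)

lemma integral_sampleTime_pos (a₀ : ℝ) (K : ℕ) :
    ((K : ℝ) + 1) * (∫ x, x ∂(P : Measure ℝ)) ≤
      ∫ ω, π.sampleTime a₀ ω.1 ω.2 (K + 2) ∂(seedDelayLaw P) := by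
  rw [π.integral_sampleTime hP]
  refine (Finset.card_nsmul_le_sum _ _ _ fun i _ => π.mean_le_integral_cycle hP i).trans' ?_
  simp

/-- The ratio `aoiRatio` in terms of the expected Lagrangians of the cycles. -/
lemma aoiRatio_eq (a₀ γ : ℝ) (K : ℕ) :
    aoiRatio a₀ π P (K + 1) = (∫ x, x ∂(P : Measure ℝ)) + γ +
      ((∫ x, x ∂(P : Measure ℝ)) * (a₀ - ∫ ω, π.cycle ω.1 ω.2 K ∂(seedDelayLaw P)) +
        ∑ i ∈ Finset.range (K + 1),
          ∫ ω, lagrangian γ (π.cycle ω.1 ω.2 i) ∂(seedDelayLaw P)) /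
      ∫ ω, π.sampleTime a₀ ω.1 ω.2 (K + 2) ∂(seedDelayLaw P) := by
  have hT := π.integral_sampleTime_pos hP a₀ K
  have hT0 : ∫ ω, π.sampleTime a₀ ω.1 ω.2 (K + 2) ∂(seedDelayLaw P) ≠ 0 :=
    (hT.trans_lt' (mul_pos (by positivity) hP.mean_pos)).ne'
  rw [aoiRatio, π.integral_integral_age hP, div_eq_iff hT0, add_mul, div_mul_cancel₀ _ hT0,
    π.integral_sampleTime hP]
  simp only [π.integral_lagrangian_cycle hP]
  -- Each delay is paired with the preceding increment. Reindexing therefore trades the last cycle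
  -- for the initial age a₀, which is the boundary term.
  rw [Finset.sum_add_distrib, Finset.sum_sub_distrib, ← Finset.sum_mul, ← Finset.mul_sum,
    Finset.sum_range_succ']
  rw [Finset.sum_range_succ (fun i => ∫ ω, π.cycle ω.1 ω.2 i ∂(seedDelayLaw P))]
  simp only [meanIncrement]
  ring

end CausalPolicy

end SeedDelayLaw

/-! ### The threshold policy and the minimum average age. -/

namespace CausalPolicy

variable {Wub : ℝ} {P : ProbabilityMeasure ℝ}

lemma expMinLagrangian_le_integral_cycle (π : CausalPolicy Wub) (hP : IsDelayLaw (P : Measure ℝ))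
    (hW : 0 ≤ Wub) (γ : ℝ) (k : ℕ) :
    expMinLagrangian Wub P γ ≤ ∫ ω, lagrangian γ (π.cycle ω.1 ω.2 k) ∂(seedDelayLaw P) := by
  have h := measurePreserving_delay P k
  rw [expMinLagrangian, ← h.map_eq, integral_map h.aemeasurable
    (continuous_minLagrangian Wub γ).aestronglyMeasurable]
  refine integral_mono (h.integrable_comp_of_integrable (hP.integrable_minLagrangian hW γ))
    (π.integrable_lagrangian_cycle hP γ k) fun ω => ?_
  exact minLagrangian_le γ (π.le_cycle _ _ _) (π.cycle_le _ _ _)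

/-- The policy that waits until the cycle has length `γ`, as far as the constraint on the waiting
times allows. -/
noncomputable def threshold (hW : 0 ≤ Wub) (γ : ℝ) : CausalPolicy Wub where
  wait
    -- The value at index 0 never enters a sampling time.
    | 0, _, _ => 0
    | _ + 1, _, h => max 0 (min (γ - h (Fin.last _)) Wub)
  measurable_wait
    | 0 => measurable_const
    | k + 1 => by
      change Measurable fun p : I × (Fin (k + 1) → ℝ) => max 0 (min (γ - p.2 (Fin.last k)) Wub)
      fun_prop
  wait_nonneg
    | 0, _, _ => le_rfl
    | _ + 1, _, _ => le_max_left _ _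
  wait_le
    | 0, _, _ => hW
    | _ + 1, _, _ => max_le hW (min_le_right _ _)

lemma integral_lagrangian_cycle_threshold (hW : 0 ≤ Wub) (γ : ℝ) (k : ℕ) :
    ∫ ω, lagrangian γ ((threshold hW γ).cycle ω.1 ω.2 k) ∂(seedDelayLaw P) =
      expMinLagrangian Wub P γ := by
  have h := measurePreserving_delay P k
  rw [expMinLagrangian, ← h.map_eq, integral_map h.aemeasurable
    (continuous_minLagrangian Wub γ).aestronglyMeasurable]
  rfl

lemma tendsto_const_div_sampleTime (π : CausalPolicy Wub) (hP : IsDelayLaw (P : Measure ℝ))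
    (a₀ : ℝ) {e : ℕ → ℝ} {C : ℝ} (he : ∀ K, |e K| ≤ C) :
    Tendsto (fun K : ℕ => e K / ∫ ω, π.sampleTime a₀ ω.1 ω.2 (K + 2) ∂(seedDelayLaw P)) atTop
      (𝓝 0) := by
  have hm := hP.mean_pos
  have hC : 0 ≤ C := (abs_nonneg _).trans (he 0)
  refine squeeze_zero_norm (a := fun K : ℕ => C / (∫ x, x ∂(P : Measure ℝ)) * (1 / ((K : ℝ) + 1)))
    (fun K => ?_) ?_
  · have hT := π.integral_sampleTime_pos hP a₀ K
    have h0 : 0 < ((K : ℝ) + 1) * (∫ x, x ∂(P : Measure ℝ)) := by positivity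
    rw [norm_div, Real.norm_eq_abs, Real.norm_of_nonneg (h0.le.trans hT), div_mul_div_comm,
      mul_one, mul_comm (∫ x, x ∂(P : Measure ℝ))]
    exact div_le_div₀ hC (he K) h0 hT
  · simpa using tendsto_one_div_add_atTop_nhds_zero_nat.const_mul (C / ∫ x, x ∂(P : Measure ℝ))

lemma abs_mean_mul_le (π : CausalPolicy Wub) (hP : IsDelayLaw (P : Measure ℝ)) (a₀ : ℝ) (K : ℕ) :
    |(∫ x, x ∂(P : Measure ℝ)) * (a₀ - ∫ ω, π.cycle ω.1 ω.2 K ∂(seedDelayLaw P))| ≤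
      (∫ x, x ∂(P : Measure ℝ)) * (|a₀| + ((∫ x, x ∂(P : Measure ℝ)) + Wub)) := by
  have hm := hP.mean_pos
  rw [abs_mul, abs_of_pos hm]
  refine mul_le_mul_of_nonneg_left ((abs_sub _ _).trans (add_le_add_right ?_ _)) hm.le
  rw [abs_of_nonneg (hm.le.trans (π.mean_le_integral_cycle hP K))]
  exact π.integral_cycle_le hP K

end CausalPolicy

section Threshold

variable {Wub : ℝ} {P : ProbabilityMeasure ℝ}

open CausalPolicy

/-- At the root every cycle has nonnegative expected Lagrangian. What remains in `aoiRatio_eq` is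
bounded over a horizon that grows at least linearly, so it vanishes in the limit. -/
lemma le_averageAoI (hP : IsDelayLaw (P : Measure ℝ)) (hW : 0 ≤ Wub) (a₀ : ℝ)
    (π : CausalPolicy Wub) {γ : ℝ} (hγ : expMinLagrangian Wub P γ = 0) :
    (∫ x, x ∂(P : Measure ℝ)) + γ ≤ averageAoI a₀ π P := by
  have hm := hP.mean_pos
  set m := ∫ x, x ∂(P : Measure ℝ) with hmdef
  have ht := (π.tendsto_const_div_sampleTime hP a₀ (π.abs_mean_mul_le hP a₀)).const_add (m + γ)
  rw [add_zero] at ht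
  rw [averageAoI, ← limsup_nat_add _ 1, ← ht.limsup_eq]
  set C := (∫ x, (x + Wub) ^ 2 ∂(P : Measure ℝ)) + γ ^ 2 with hC
  have hC0 : 0 ≤ C := add_nonneg (integral_nonneg fun x => sq_nonneg _) (sq_nonneg _)
  have hbound : ∀ i, ∫ ω, lagrangian γ (π.cycle ω.1 ω.2 i) ∂(seedDelayLaw P) ≤ C := by
    intro i
    have h := measurePreserving_delay P i
    have hi : Integrable (fun x => (x + Wub) ^ 2) (P : Measure ℝ) :=
      (hP.memLp.add (memLp_const Wub)).integrable_sq
    have hi' : Integrable (fun ω : I × (ℕ → ℝ) => (ω.2 i + Wub) ^ 2) (seedDelayLaw P) :=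
      h.integrable_comp_of_integrable hi
    have e : ∫ ω : I × (ℕ → ℝ), (ω.2 i + Wub) ^ 2 + γ ^ 2 ∂(seedDelayLaw P) = C := by
      rw [integral_add hi' (integrable_const _), hC, ← h.map_eq,
        integral_map h.aemeasurable (by fun_prop)]
      simp
    rw [← e]
    refine integral_mono_ae (π.integrable_lagrangian_cycle hP γ i)
      (hi'.add (integrable_const _)) ((ae_delay_nonneg P hP).mono fun ω hω => ?_)
    have h1 := pow_le_pow_left₀ (π.cycle_nonneg _ _ hω i) (π.cycle_le ω.1 ω.2 i) 2
    simp only [lagrangian]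
    nlinarith [sq_nonneg (π.cycle ω.1 ω.2 i + γ)]
  refine limsup_le_limsup (Eventually.of_forall fun K => ?_) ht.isCoboundedUnder_le ?_
  · simp only
    rw [π.aoiRatio_eq hP a₀ γ K]
    refine add_le_add_right (div_le_div_of_nonneg_right ?_
      ((by positivity : (0 : ℝ) ≤ (K + 1) * m).trans (π.integral_sampleTime_pos hP a₀ K))) _
    refine le_add_of_nonneg_right (Finset.sum_nonneg fun i _ => ?_)
    rw [← hγ]
    exact π.expMinLagrangian_le_integral_cycle hP hW γ i
  -- The real `limsup` takes a default value on sequences unbounded above, so an upper bound on the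
  -- ratios is needed.
  · refine isBoundedUnder_of ⟨m + γ + (m * |a₀| + C) / m, fun K => ?_⟩
    have hT := π.integral_sampleTime_pos hP a₀ K
    rw [π.aoiRatio_eq hP a₀ γ K]
    refine add_le_add_right (div_le_of_le_mul₀ ((by positivity : (0 : ℝ) ≤ (K + 1) * m).trans hT)
      (by positivity) ?_) _
    calc _ ≤ m * |a₀| + ∑ i ∈ Finset.range (K + 1), C := by
          refine add_le_add (mul_le_mul_of_nonneg_left ?_ hm.le)
            (Finset.sum_le_sum fun i _ => hbound i)
          linarith [le_abs_self a₀, π.mean_le_integral_cycle hP K]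
      _ ≤ (m * |a₀| + C) / m * ((K + 1) * m) := by
          rw [Finset.sum_const, Finset.card_range, nsmul_eq_mul]
          have : (m * |a₀| + C) / m * ((K + 1) * m) = (m * |a₀| + C) * (K + 1) := by field_simp
          rw [this]
          push_cast
          nlinarith [mul_nonneg (mul_nonneg hm.le (abs_nonneg a₀)) (Nat.cast_nonneg (α := ℝ) K)]
      _ ≤ _ := mul_le_mul_of_nonneg_left hT (by positivity)

/-- The policy attains the pointwise minimum in each cycle, so at the root all expected Lagrangians
vanish and only the boundary term is left. -/
lemma averageAoI_threshold (hP : IsDelayLaw (P : Measure ℝ)) (hW : 0 ≤ Wub) (a₀ : ℝ) {γ : ℝ}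
    (hγ : expMinLagrangian Wub P γ = 0) :
    averageAoI a₀ (threshold hW γ) P = (∫ x, x ∂(P : Measure ℝ)) + γ := by
  set π := threshold hW γ with hπ
  have ht := (π.tendsto_const_div_sampleTime hP a₀ (π.abs_mean_mul_le hP a₀)).const_add
    ((∫ x, x ∂(P : Measure ℝ)) + γ)
  rw [add_zero] at ht
  rw [averageAoI, ← limsup_nat_add _ 1, ← ht.limsup_eq]
  congr 1
  ext K
  rw [π.aoiRatio_eq hP a₀ γ K]
  simp only [hπ, integral_lagrangian_cycle_threshold, hγ, Finset.sum_const_zero, add_zero]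

/-- The minimum average age is the mean delay plus the root of the expected least Lagrangian. -/
theorem optimalAoI_eq (hP : IsDelayLaw (P : Measure ℝ)) (hW : 0 ≤ Wub) (a₀ : ℝ) {γ : ℝ}
    (hγ : expMinLagrangian Wub P γ = 0) :
    optimalAoI a₀ Wub P = (∫ x, x ∂(P : Measure ℝ)) + γ := by
  have : Nonempty (CausalPolicy Wub) := ⟨threshold hW γ⟩
  refine le_antisymm ?_ (le_ciInf fun π => le_averageAoI hP hW a₀ π hγ)
  rw [← averageAoI_threshold hP hW a₀ hγ]
  refine ciInf_le ⟨(∫ x, x ∂(P : Measure ℝ)) + γ, ?_⟩ _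
  rintro _ ⟨π, rfl⟩
  exact le_averageAoI hP hW a₀ π hγ

theorem optimalThreshold_eq (hP : IsDelayLaw (P : Measure ℝ)) (hW : 0 ≤ Wub) (a₀ : ℝ) {γ : ℝ}
    (hγ : expMinLagrangian Wub P γ = 0) :
    optimalThreshold a₀ Wub P = γ := by
  rw [optimalThreshold, optimalAoI_eq hP hW a₀ hγ, add_sub_cancel_left]

end Threshold

/-! ### Tilted product laws and the two-point method. -/

lemma MeasureTheory.Measure.pi_withDensity_const {n : ℕ} (Q : Measure ℝ) [IsProbabilityMeasure Q]
    {f : ℝ → ℝ≥0∞} (hf : Measurable f) [SigmaFinite (Q.withDensity f)] :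
    Measure.pi (fun _ : Fin n => Q.withDensity f) =
      (Measure.pi fun _ : Fin n => Q).withDensity fun x => ∏ i, f (x i) := by
  refine Measure.pi_eq fun t ht => ?_
  have hind : iIndepFun (fun (i : Fin n) (x : Fin n → ℝ) => (t i).indicator f (x i))
      (Measure.pi fun _ : Fin n => Q) :=
    iIndepFun_pi (X := fun i => (t i).indicator f) fun i => (hf.indicator (ht i)).aemeasurable
  have h := lintegral_prod_eq_prod_lintegral_of_indepFun Finset.univ _ hind
    fun i => (hf.indicator (ht i)).comp (measurable_pi_apply i)
  rw [withDensity_apply _ (MeasurableSet.univ_pi ht),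
    ← lintegral_indicator (MeasurableSet.univ_pi ht)]
  have e : (Set.univ.pi t).indicator (fun x : Fin n → ℝ => ∏ i, f (x i)) =
      fun x => ∏ i, (t i).indicator f (x i) := by
    ext x
    by_cases hx : x ∈ Set.univ.pi t
    · rw [Set.indicator_of_mem hx]
      exact Finset.prod_congr rfl fun i _ => (Set.indicator_of_mem (hx i trivial) f).symm
    · rw [Set.indicator_of_notMem hx]
      simp only [Set.mem_univ_pi, not_forall] at hx
      obtain ⟨i, hi⟩ := hx
      exact (Finset.prod_eq_zero (Finset.mem_univ i) (Set.indicator_of_notMem hi f)).symm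
  rw [e, h]
  refine Finset.prod_congr rfl fun i _ => ?_
  have := (measurePreserving_eval (fun _ : Fin n => Q) i).lintegral_comp (hf.indicator (ht i))
  rw [withDensity_apply _ (ht i), ← lintegral_indicator (ht i), ← this]

/-- A bounded score function for the law `Q`: a direction in which `Q` can be tilted. -/
structure IsScore (Q : Measure ℝ) (s : ℝ → ℝ) : Prop where
  measurable : Measurable s
  abs_le_one : ∀ x, |s x| ≤ 1
  integral_eq_zero : ∫ x, s x ∂Q = 0

/-- The parameter clamped to `[-1, 1]`. -/
def clampUnit (θ : ℝ) : ℝ := max (-1) (min 1 θ)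

lemma abs_clampUnit_le (θ : ℝ) : |clampUnit θ| ≤ 1 :=
  abs_le.2 ⟨le_max_left _ _, max_le (by norm_num) (min_le_left _ _)⟩

lemma clampUnit_of_abs_le {θ : ℝ} (h : |θ| ≤ 1) : clampUnit θ = θ := by
  rw [clampUnit, min_eq_right (abs_le.1 h).2, max_eq_right (abs_le.1 h).1]

/-- The law `Q` tilted by the density `1 + θ s`, where `θ` is clamped to `[-1, 1]`. -/
noncomputable def tilt (Q : Measure ℝ) (s : ℝ → ℝ) (θ : ℝ) : Measure ℝ :=
  Q.withDensity fun x => ENNReal.ofReal (1 + clampUnit θ * s x)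

namespace IsScore

variable {Q : Measure ℝ} [IsProbabilityMeasure Q] {s : ℝ → ℝ} (hs : IsScore Q s)
include hs

omit [IsProbabilityMeasure Q] in
lemma one_add_nonneg {θ : ℝ} (hθ : |θ| ≤ 1) (x : ℝ) : 0 ≤ 1 + θ * s x := by
  have : |θ * s x| ≤ 1 := by
    rw [abs_mul]; exact mul_le_one₀ hθ (abs_nonneg _) (hs.abs_le_one x)
  linarith [(abs_le.1 this).1]

omit [IsProbabilityMeasure Q] in
lemma measurable_density (θ : ℝ) :
    Measurable fun x => ENNReal.ofReal (1 + clampUnit θ * s x) :=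
  ((hs.measurable.const_mul _).const_add _).ennreal_ofReal

omit [IsProbabilityMeasure Q] in
lemma integrable_mul {f : ℝ → ℝ} (hf : Integrable f Q) : Integrable (fun x => s x * f x) Q :=
  hf.bdd_mul hs.measurable.aestronglyMeasurable (ae_of_all _ hs.abs_le_one)

omit [IsProbabilityMeasure Q] in
lemma integrable_tilt {f : ℝ → ℝ} (hf : Integrable f Q) (θ : ℝ) : Integrable f (tilt Q s θ) := by
  rw [tilt, integrable_withDensity_iff (hs.measurable_density θ) (by simp)]
  have : (fun x => f x * (ENNReal.ofReal (1 + clampUnit θ * s x)).toReal) =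
      fun x => f x + clampUnit θ * (s x * f x) := by
    ext x
    rw [ENNReal.toReal_ofReal (hs.one_add_nonneg (abs_clampUnit_le θ) x)]
    ring
  rw [this]
  exact hf.add ((hs.integrable_mul hf).const_mul _)

omit [IsProbabilityMeasure Q] in
lemma integral_tilt {f : ℝ → ℝ} (hf : Integrable f Q) (θ : ℝ) :
    ∫ x, f x ∂(tilt Q s θ) = (∫ x, f x ∂Q) + clampUnit θ * ∫ x, s x * f x ∂Q := by
  rw [tilt, integral_withDensity_eq_integral_toReal_smul (hs.measurable_density θ) (by simp),
    ← integral_const_mul, ← integral_add hf ((hs.integrable_mul hf).const_mul _)]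
  refine integral_congr_ae (ae_of_all _ fun x => ?_)
  simp only [smul_eq_mul]
  rw [ENNReal.toReal_ofReal (hs.one_add_nonneg (abs_clampUnit_le θ) x)]
  ring

lemma isProbabilityMeasure_tilt (θ : ℝ) : IsProbabilityMeasure (tilt Q s θ) := by
  have hi : Integrable s Q := by simpa using hs.integrable_mul (integrable_const (1 : ℝ))
  have hi' : Integrable (fun x => 1 + clampUnit θ * s x) Q :=
    (integrable_const _).add (hi.const_mul _)
  refine ⟨?_⟩
  rw [tilt, withDensity_apply _ MeasurableSet.univ, Measure.restrict_univ,
    ← ofReal_integral_eq_lintegral_ofReal hi'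
      (ae_of_all _ fun x => hs.one_add_nonneg (abs_clampUnit_le θ) x),
    integral_add (integrable_const _) (hi.const_mul _), integral_const_mul, hs.integral_eq_zero]
  simp

/-- The tilted law as a probability measure. -/
noncomputable def law (θ : ℝ) : ProbabilityMeasure ℝ :=
  ⟨tilt Q s θ, hs.isProbabilityMeasure_tilt θ⟩

lemma law_absolutelyContinuous (θ : ℝ) : (hs.law θ : Measure ℝ) ≪ Q :=
  withDensity_absolutelyContinuous _ _

lemma integrable_law {f : ℝ → ℝ} (hf : Integrable f Q) (θ : ℝ) :
    Integrable f (hs.law θ : Measure ℝ) := hs.integrable_tilt hf θ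

lemma integral_law {f : ℝ → ℝ} (hf : Integrable f Q) (θ : ℝ) :
    ∫ x, f x ∂(hs.law θ : Measure ℝ) = (∫ x, f x ∂Q) + clampUnit θ * ∫ x, s x * f x ∂Q :=
  hs.integral_tilt hf θ

/-- Moves all parameters θ to one reference measure, so that risks under different laws can be
compared pointwise and integrated over θ. -/
lemma lintegral_pi_law {n : ℕ} {F : (Fin n → ℝ) → ℝ≥0∞} (hF : Measurable F) {θ : ℝ}
    (hθ : |θ| ≤ 1) :
    ∫⁻ x, F x ∂(Measure.pi fun _ : Fin n => (hs.law θ : Measure ℝ)) =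
      ∫⁻ x, ENNReal.ofReal (∏ i, (1 + θ * s (x i))) * F x ∂(Measure.pi fun _ : Fin n => Q) := by
  have := hs.isProbabilityMeasure_tilt θ
  change ∫⁻ x, F x ∂(Measure.pi fun _ : Fin n => tilt Q s θ) = _
  unfold tilt at this ⊢
  have hm := hs.measurable_density θ
  have hm' : Measurable fun x : Fin n → ℝ =>
      ∏ i, ENNReal.ofReal (1 + clampUnit θ * s (x i)) :=
    Finset.measurable_prod _ fun i _ => hm.comp (measurable_pi_apply i)
  rw [Measure.pi_withDensity_const Q hm, lintegral_withDensity_eq_lintegral_mul _ hm' hF]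
  refine lintegral_congr fun x => ?_
  rw [ENNReal.ofReal_prod_of_nonneg fun i _ => hs.one_add_nonneg hθ (x i),
    clampUnit_of_abs_le hθ]
  simp

end IsScore

/-- The minimum over a of the weighted errors is q q' (g - g')² / (q + q'). With the hypothesis this
is at least p² (g - g')² / (2 (q + q')), and AM-GM against (q + q')/8 leaves p/2. -/
lemma two_point_pointwise {a g g' p q q' : ℝ} (hq : 0 ≤ q) (hq' : 0 ≤ q')
    (h : p ^ 2 / 2 ≤ q * q') :
    (g - g') ^ 2 / 2 * p ≤
      (q * (a - g) ^ 2 + q' * (a - g') ^ 2) + (g - g') ^ 2 / 8 * (q + q') := by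
  rcases (add_nonneg hq hq').eq_or_lt with h0 | h0
  · have e : q = 0 := by linarith
    have e' : q' = 0 := by linarith
    subst e; subst e'
    have : p = 0 := by nlinarith [sq_nonneg p]
    simp [this]
  · refine le_of_mul_le_mul_left ?_ h0
    have h1 := mul_le_mul_of_nonneg_left h (sq_nonneg (g - g'))
    nlinarith [sq_nonneg (q * (a - g) + q' * (a - g')), sq_nonneg ((g - g') * (2 * p - (q + q')))]

/-- Each factor on the right is (1 + θs)² - ε²s², and 1 + θs ≥ 1/2 makes the loss at most a factor 1
- 4ε². Bernoulli's inequality bounds the n-th power of that factor below by 1/2. -/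
lemma prod_tilt_mul_le {n : ℕ} {s : Fin n → ℝ} (hs : ∀ i, |s i| ≤ 1) {θ ε : ℝ} (hθ : |θ| ≤ 1 / 2)
    (hε : 8 * n * ε ^ 2 ≤ 1) (hε' : |ε| ≤ 1 / 2) :
    (∏ i, (1 + θ * s i)) ^ 2 / 2 ≤ (∏ i, (1 + (θ - ε) * s i)) * ∏ i, (1 + (θ + ε) * s i) := by
  have hpos : ∀ i, 1 / 2 ≤ 1 + θ * s i := fun i => by
    have : |θ * s i| ≤ 1 / 2 := by
      rw [abs_mul]
      nlinarith [abs_nonneg θ, abs_nonneg (s i), hs i]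
    linarith [(abs_le.1 this).1]
  have hε2 : ε ^ 2 ≤ 1 / 4 := by
    rw [← sq_abs]; nlinarith [abs_nonneg ε]
  have hs2 : ∀ i, s i ^ 2 ≤ 1 := fun i => (sq_le_one_iff_abs_le_one _).2 (hs i)
  have hfac : ∀ i, (1 + θ * s i) ^ 2 * (1 - 4 * ε ^ 2) ≤
      (1 + (θ - ε) * s i) * (1 + (θ + ε) * s i) := fun i => by
    have h1 : ε ^ 2 * s i ^ 2 ≤ ε ^ 2 * (4 * (1 + θ * s i) ^ 2) :=
      mul_le_mul_of_nonneg_left (by nlinarith [hpos i, hs2 i]) (sq_nonneg _)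
    nlinarith
  calc (∏ i, (1 + θ * s i)) ^ 2 / 2 ≤ (∏ i, (1 + θ * s i)) ^ 2 * (1 - 4 * ε ^ 2) ^ n := by
        have hb := one_add_mul_le_pow (a := -(4 * ε ^ 2)) (by linarith) n
        rw [div_eq_mul_one_div]
        refine mul_le_mul_of_nonneg_left ?_ (sq_nonneg _)
        rw [sub_eq_add_neg]
        linarith
    _ = ∏ i, (1 + θ * s i) ^ 2 * (1 - 4 * ε ^ 2) := by
        rw [Finset.prod_mul_distrib, Finset.prod_pow, Finset.prod_const, Finset.card_univ,
          Fintype.card_fin]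
    _ ≤ ∏ i, (1 + (θ - ε) * s i) * (1 + (θ + ε) * s i) :=
        Finset.prod_le_prod (fun i _ => mul_nonneg (sq_nonneg _) (by linarith)) fun i _ => hfac i
    _ = _ := Finset.prod_mul_distrib

/-- **Two-point lower bound**: no estimator is good under both of the laws with parameters
`θ - ε` and `θ + ε`, even if its error counts only when the observation `x j` lies in `A`. -/
theorem IsScore.two_point {Q : Measure ℝ} [IsProbabilityMeasure Q] {s : ℝ → ℝ} (hs : IsScore Q s)
    {n : ℕ} {f : (Fin n → ℝ) → ℝ} (hf : Measurable f) (j : Fin n) {A : Set ℝ}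
    (hA : MeasurableSet A) {θ ε : ℝ} (hθ : |θ| ≤ 1 / 2) (hε : 8 * n * ε ^ 2 ≤ 1)
    (hε' : |ε| ≤ 1 / 2) (g g' : ℝ) :
    ENNReal.ofReal ((g - g') ^ 2 / 4 * (hs.law θ : Measure ℝ).real A) ≤
      (∫⁻ x, A.indicator 1 (x j) * ENNReal.ofReal ((f x - g) ^ 2)
        ∂(Measure.pi fun _ : Fin n => (hs.law (θ - ε) : Measure ℝ))) +
      ∫⁻ x, A.indicator 1 (x j) * ENNReal.ofReal ((f x - g') ^ 2)
        ∂(Measure.pi fun _ : Fin n => (hs.law (θ + ε) : Measure ℝ)) := by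
  have hθ1 : |θ| ≤ 1 := by linarith
  have hm : |θ - ε| ≤ 1 := (abs_sub _ _).trans (by linarith)
  have hp : |θ + ε| ≤ 1 := (abs_add_le _ _).trans (by linarith)
  have hAj : Measurable fun x : Fin n → ℝ => A.indicator (1 : ℝ → ℝ≥0∞) (x j) :=
    (measurable_one.indicator hA).comp (measurable_pi_apply j)
  have hmass : ∀ τ, |τ| ≤ 1 → (hs.law τ : Measure ℝ) A =
      ∫⁻ x, ENNReal.ofReal (∏ i, (1 + τ * s (x i))) * A.indicator 1 (x j)
        ∂(Measure.pi fun _ : Fin n => Q) := fun τ hτ => by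
    rw [← hs.lintegral_pi_law hAj hτ, (measurePreserving_eval (fun _ : Fin n =>
      (hs.law τ : Measure ℝ)) j).lintegral_comp (measurable_one.indicator hA),
      lintegral_indicator_one hA]
  have hprod : ∀ τ : ℝ, Measurable fun x : Fin n → ℝ =>
      ENNReal.ofReal (∏ i, (1 + τ * s (x i))) := fun τ =>
    (Finset.measurable_prod _ fun i _ =>
      ((hs.measurable.comp (measurable_pi_apply i)).const_mul _).const_add _).ennreal_ofReal
  have hF : ∀ g : ℝ, Measurable fun x : Fin n → ℝ =>
      A.indicator (1 : ℝ → ℝ≥0∞) (x j) * ENNReal.ofReal ((f x - g) ^ 2) := fun g =>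
    hAj.mul ((hf.sub_const g).pow_const 2).ennreal_ofReal
  have hpF : ∀ τ g : ℝ, Measurable fun x : Fin n → ℝ => ENNReal.ofReal (∏ i, (1 + τ * s (x i))) *
      (A.indicator (1 : ℝ → ℝ≥0∞) (x j) * ENNReal.ofReal ((f x - g) ^ 2)) := fun τ g =>
    (hprod τ).mul (hF g)
  have hpA : ∀ τ : ℝ, Measurable fun x : Fin n → ℝ => ENNReal.ofReal (∏ i, (1 + τ * s (x i))) *
      A.indicator (1 : ℝ → ℝ≥0∞) (x j) := fun τ => (hprod τ).mul hAj
  have key : ENNReal.ofReal ((g - g') ^ 2 / 2) * (hs.law θ : Measure ℝ) A ≤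
      ((∫⁻ x, A.indicator 1 (x j) * ENNReal.ofReal ((f x - g) ^ 2)
        ∂(Measure.pi fun _ : Fin n => (hs.law (θ - ε) : Measure ℝ))) +
      ∫⁻ x, A.indicator 1 (x j) * ENNReal.ofReal ((f x - g') ^ 2)
        ∂(Measure.pi fun _ : Fin n => (hs.law (θ + ε) : Measure ℝ))) +
      ENNReal.ofReal ((g - g') ^ 2 / 8) *
        ((hs.law (θ - ε) : Measure ℝ) A + (hs.law (θ + ε) : Measure ℝ) A) := by
    rw [hmass θ hθ1, hmass _ hm, hmass _ hp, hs.lintegral_pi_law (hF g) hm,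
      hs.lintegral_pi_law (hF g') hp,
      ← lintegral_add_left (hpF _ _), ← lintegral_add_left (hpA _),
      ← lintegral_const_mul _ (hpA _), ← lintegral_const_mul _ ((hpA _).fun_add (hpA _)),
      ← lintegral_add_left ((hpF _ _).fun_add (hpF _ _))]
    refine lintegral_mono fun x => ?_
    by_cases hx : x j ∈ A
    · have h1 : ∀ τ, |τ| ≤ 1 → 0 ≤ ∏ i, (1 + τ * s (x i)) := fun τ hτ =>
        Finset.prod_nonneg fun i _ => hs.one_add_nonneg hτ (x i)
      have h2 := two_point_pointwise (a := f x) (g := g) (g' := g') (h1 _ hm) (h1 _ hp)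
        (prod_tilt_mul_le (fun i => hs.abs_le_one (x i)) hθ hε hε')
      simp only [Set.indicator_of_mem hx, Pi.one_apply, mul_one, one_mul]
      have n1 := h1 _ hm
      have n2 := h1 _ hp
      rw [← ENNReal.ofReal_mul (by positivity), ← ENNReal.ofReal_mul n1, ← ENNReal.ofReal_mul n2,
        ← ENNReal.ofReal_add n1 n2, ← ENNReal.ofReal_add (by positivity) (by positivity),
        ← ENNReal.ofReal_mul (by positivity), ← ENNReal.ofReal_add (by positivity) (by positivity)]
      exact ENNReal.ofReal_le_ofReal h2
    · simp [Set.indicator_of_notMem hx]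
  -- The mass of A is affine in θ, so the correction term is exactly half of the left side of `key`
  -- and can be cancelled.
  have hsum : (hs.law (θ - ε) : Measure ℝ).real A + (hs.law (θ + ε) : Measure ℝ).real A =
      2 * (hs.law θ : Measure ℝ).real A := by
    have hr : ∀ τ, |τ| ≤ 1 → (hs.law τ : Measure ℝ).real A =
        Q.real A + τ * ∫ x, s x * A.indicator 1 x ∂Q := fun τ hτ => by
      rw [← integral_indicator_one hA, ← integral_indicator_one hA,
        hs.integral_law (f := A.indicator 1)
          ((integrable_indicator_iff hA).2 (integrable_const 1).integrableOn),
        clampUnit_of_abs_le hτ]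
    rw [hr _ hm, hr _ hp, hr _ hθ1]
    ring
  rw [← ofReal_measureReal (μ := (hs.law θ : Measure ℝ)),
    ← ofReal_measureReal (μ := (hs.law (θ - ε) : Measure ℝ)),
    ← ofReal_measureReal (μ := (hs.law (θ + ε) : Measure ℝ)),
    ← ENNReal.ofReal_add measureReal_nonneg measureReal_nonneg, hsum,
    ← ENNReal.ofReal_mul (by positivity), ← ENNReal.ofReal_mul (by positivity)] at key
  have e : (g - g') ^ 2 / 2 * (hs.law θ : Measure ℝ).real A =
      (g - g') ^ 2 / 4 * (hs.law θ : Measure ℝ).real A +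
        (g - g') ^ 2 / 8 * (2 * (hs.law θ : Measure ℝ).real A) := by ring
  rw [e, ENNReal.ofReal_add (by positivity) (by positivity)] at key
  exact (ENNReal.add_le_add_iff_right ENNReal.ofReal_ne_top).1 key

/-! ### Movement of the root under tilts. -/

lemma IsDelayLaw.root_gap {P : Measure ℝ} [IsProbabilityMeasure P] {Wub : ℝ} (hP : IsDelayLaw P)
    (hW : 0 ≤ Wub) {γ γ' : ℝ} (h : expMinLagrangian Wub P γ < expMinLagrangian Wub P γ') :
    (expMinLagrangian Wub P γ' - expMinLagrangian Wub P γ) / ((∫ x, x ∂P) + Wub) ≤ γ - γ' := by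
  have hlt := (hP.strictAnti_expMinLagrangian hW).lt_iff_gt.1 h
  have hm := hP.mean_pos
  rw [div_le_iff₀ (by linarith)]
  linarith [hP.expMinLagrangian_le_add hW hlt.le]

/-- Absolute continuity excludes an atom at 0, which forces a positive mean. -/
lemma IsDelayLaw.of_absolutelyContinuous {P : Measure ℝ} [IsProbabilityMeasure P]
    (hac : P ≪ volume) (h0 : ∀ᵐ x ∂P, 0 ≤ x) (h2 : Integrable (fun x : ℝ => x ^ 2) P) :
    IsDelayLaw P := by
  refine ⟨h0, h2, ?_⟩
  have hi : Integrable (fun x : ℝ => x) P :=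
    ((memLp_two_iff_integrable_sq measurable_id.aestronglyMeasurable).2 h2).integrable one_le_two
  rw [integral_pos_iff_support_of_nonneg_ae h0 hi]
  have hz : P {0} = 0 := hac Real.volume_singleton
  have hs : Function.support (fun x : ℝ => x) = {0}ᶜ := by ext; simp
  rw [hs, prob_compl_eq_one_sub (measurableSet_singleton 0), hz]
  simp

lemma IsScore.isDelayLaw {Q : Measure ℝ} [IsProbabilityMeasure Q] {s : ℝ → ℝ} (hs : IsScore Q s)
    (hac : Q ≪ volume) (hQ : IsDelayLaw Q) (θ : ℝ) : IsDelayLaw (hs.law θ : Measure ℝ) :=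
  .of_absolutelyContinuous ((hs.law_absolutelyContinuous θ).trans hac)
    ((hs.law_absolutelyContinuous θ).ae_le hQ.nonneg) (hs.integrable_law hQ.integrable_sq θ)

lemma IsScore.expMinLagrangian_law {Q : Measure ℝ} [IsProbabilityMeasure Q] {s : ℝ → ℝ}
    (hs : IsScore Q s) (hQ : IsDelayLaw Q) {Wub : ℝ} (hW : 0 ≤ Wub) (θ γ : ℝ) :
    expMinLagrangian Wub (hs.law θ : Measure ℝ) γ =
      expMinLagrangian Wub Q γ + clampUnit θ * ∫ x, s x * minLagrangian Wub γ x ∂Q :=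
  hs.integral_law (hQ.integrable_minLagrangian hW γ) θ

/-! ### A score orthogonal to the first two moments. -/

section Score

/-- A multiple of the third Legendre polynomial, on `[-1, 1]`. -/
def legendreThree (y : ℝ) : ℝ := 5 * y ^ 3 - 3 * y

lemma continuous_legendreThree : Continuous legendreThree := by unfold legendreThree; fun_prop

lemma abs_legendreThree_le {y : ℝ} (hy : |y| ≤ 1) : |legendreThree y| ≤ 8 := by
  have h3 : |y ^ 3| ≤ 1 := by rw [abs_pow]; exact pow_le_one₀ (abs_nonneg _) hy
  rw [abs_le] at *
  rw [legendreThree]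
  constructor <;> linarith [h3.1, h3.2, hy.1, hy.2]

/-- General endpoints are needed because the least Lagrangian is a different quadratic on each side
of the threshold. -/
lemma integral_legendreThree_mul_quadratic (a b A B C : ℝ) :
    ∫ y in a..b, legendreThree y * (A + B * y + C * y ^ 2) =
      (A * (5 * b ^ 4 / 4 - 3 * b ^ 2 / 2) + B * (b ^ 5 - b ^ 3) +
        C * (5 * b ^ 6 / 6 - 3 * b ^ 4 / 4)) -
      (A * (5 * a ^ 4 / 4 - 3 * a ^ 2 / 2) + B * (a ^ 5 - a ^ 3) +
        C * (5 * a ^ 6 / 6 - 3 * a ^ 4 / 4)) := by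
  have hc : Continuous fun y => legendreThree y * (A + B * y + C * y ^ 2) :=
    continuous_legendreThree.mul (by fun_prop)
  refine intervalIntegral.integral_eq_sub_of_hasDerivAt (f := fun y =>
    A * (5 * y ^ 4 / 4 - 3 * y ^ 2 / 2) + B * (y ^ 5 - y ^ 3) +
        C * (5 * y ^ 6 / 6 - 3 * y ^ 4 / 4)) (fun y _ => ?_) (hc.intervalIntegrable _ _)
  have hp : ∀ n : ℕ, HasDerivAt (fun y : ℝ => y ^ n) (n * y ^ (n - 1)) y := fun n =>
    hasDerivAt_pow n y
  have := ((((((hp 4).const_mul 5).div_const 4).sub (((hp 2).const_mul 3).div_const 2)).const_mul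
    A).add (((hp 5).sub (hp 3)).const_mul B)).add
    (((((hp 6).const_mul 5).div_const 6).sub (((hp 4).const_mul 3).div_const 4)).const_mul C)
  refine this.congr_deriv ?_
  simp only [legendreThree]
  push_cast
  ring

/-- A law with a positive continuous density on `(0, ∞)` has a score that leaves its first two
moments alone but not its expected least Lagrangian. -/
lemma exists_score {f : ℝ → ℝ} (hfm : Measurable f) (hf0 : ∀ x, 0 ≤ f x)
    (hfc : ContinuousOn f (Set.Ioi 0)) (hfp : ∀ x, 0 < x → 0 < f x) {Wub γ : ℝ} (hW : 0 < Wub)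
    (hγ : 0 < γ) :
    ∃ s, IsScore (volume.withDensity fun x => ENNReal.ofReal (f x)) s ∧
      ∫ x, s x * x ∂(volume.withDensity fun x => ENNReal.ofReal (f x)) = 0 ∧
      ∫ x, s x * x ^ 2 ∂(volume.withDensity fun x => ENNReal.ofReal (f x)) = 0 ∧
      0 < ∫ x, s x * minLagrangian Wub γ x
        ∂(volume.withDensity fun x => ENNReal.ofReal (f x)) := by
  set ρ := min (γ / 2) Wub with hρ
  have hρ0 : 0 < ρ := lt_min (by linarith) hW
  have hργ : ρ ≤ γ / 2 := min_le_left _ _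
  have hρW : ρ ≤ Wub := min_le_right _ _
  set J := Set.Icc (γ - ρ) (γ + ρ) with hJ
  have hJpos : ∀ x ∈ J, 0 < x := fun x hx => by linarith [hx.1]
  obtain ⟨x₀, hx₀, hmin⟩ := (isCompact_Icc (a := γ - ρ) (b := γ + ρ)).exists_isMinOn
    ⟨γ, by constructor <;> linarith⟩ (hfc.mono hJpos)
  set c := f x₀ with hc
  have hc0 : 0 < c := hfp _ (hJpos _ hx₀)
  -- Dividing by f turns integrals against the law into Lebesgue integrals; c is the minimum of f on
  -- the window, and 8 bounds the polynomial, so |s| ≤ 1.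
  set s : ℝ → ℝ := J.indicator fun x => c / 8 * legendreThree ((x - γ) / ρ) / f x with hs
  have hint : ∀ F : ℝ → ℝ, ∫ x, s x * F x ∂(volume.withDensity fun x => ENNReal.ofReal (f x)) =
      c / 8 * (ρ * ∫ y in (-1 : ℝ)..1, legendreThree y * F (γ + ρ * y)) := by
    intro F
    have e1 : ρ * ∫ y in (-1 : ℝ)..1, legendreThree y * F (γ + ρ * y) =
        ∫ x in (γ - ρ)..(γ + ρ), legendreThree ((x - γ) / ρ) * F x := by
      have := intervalIntegral.smul_integral_comp_add_mul (a := -1) (b := 1)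
        (fun x => legendreThree ((x - γ) / ρ) * F x) ρ γ
      simp only [mul_neg, mul_one, smul_eq_mul, add_sub_cancel_left, ← sub_eq_add_neg] at this
      rw [← this]
      congr 2
      ext y
      rw [mul_div_cancel_left₀ _ hρ0.ne']
    rw [integral_withDensity_eq_integral_toReal_smul hfm.ennreal_ofReal (by simp), e1,
      intervalIntegral.integral_of_le (by linarith), ← integral_Icc_eq_integral_Ioc,
      ← integral_const_mul, ← integral_indicator measurableSet_Icc]
    congr 1
    ext x
    rw [smul_eq_mul, ENNReal.toReal_ofReal (hf0 x)]
    by_cases hx : x ∈ J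
    · have := (hfp x (hJpos x hx)).ne'
      change f x * (s x * F x) = J.indicator _ x
      simp only [hs, Set.indicator_of_mem hx]
      field_simp
    · change f x * (s x * F x) = J.indicator _ x
      simp only [hs, Set.indicator_of_notMem hx]
      ring
  have hquad : ∀ A B C : ℝ, ∫ y in (-1 : ℝ)..1, legendreThree y * (A + B * y + C * y ^ 2) = 0 := by
    intro A B C
    rw [integral_legendreThree_mul_quadratic]
    ring
  refine ⟨s, ⟨?_, fun x => ?_, ?_⟩, ?_, ?_, ?_⟩
  · refine Measurable.indicator ?_ measurableSet_Icc
    exact ((continuous_legendreThree.measurable.comp (by fun_prop)).const_mul _).div hfm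
  · by_cases hx : x ∈ J
    · have hfx := hfp x (hJpos x hx)
      have hle : c ≤ f x := hmin hx
      have hy : |(x - γ) / ρ| ≤ 1 := by
        rw [abs_div, abs_of_pos hρ0, div_le_one hρ0, abs_le]
        constructor <;> linarith [hx.1, hx.2]
      simp only [hs, Set.indicator_of_mem hx]
      rw [abs_div, abs_mul, abs_of_pos hfx, abs_of_pos (by positivity : 0 < c / 8), div_le_one hfx]
      nlinarith [abs_legendreThree_le hy]
    · simp [hs, Set.indicator_of_notMem hx]
  · have := hint fun _ => 1
    simp only [mul_one] at this
    rw [this]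
    have h := hquad 1 0 0
    simp only [zero_mul, add_zero, mul_one] at h
    rw [h]; ring
  · rw [hint fun x => x]
    have h := hquad γ ρ 0
    simp only [zero_mul, add_zero] at h
    rw [h]; ring
  · rw [hint fun x => x ^ 2]
    have h := hquad (γ ^ 2) (2 * γ * ρ) (ρ ^ 2)
    have e : (fun y => legendreThree y * (γ + ρ * y) ^ 2) =
        fun y => legendreThree y * (γ ^ 2 + 2 * γ * ρ * y + ρ ^ 2 * y ^ 2) := by ext; ring
    rw [e, h]; ring
  · rw [hint (minLagrangian Wub γ)]
    have hcont : Continuous fun y => legendreThree y * minLagrangian Wub γ (γ + ρ * y) :=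
      continuous_legendreThree.mul ((continuous_minLagrangian Wub γ).comp (by fun_prop))
    have e1 : ∫ y in (-1 : ℝ)..0, legendreThree y * minLagrangian Wub γ (γ + ρ * y) =
        ∫ y in (-1 : ℝ)..0, legendreThree y * (-(γ ^ 2 / 2) + 0 * y + 0 * y ^ 2) := by
      refine intervalIntegral.integral_congr fun y hy => ?_
      rw [Set.uIcc_of_le (by norm_num)] at hy
      rw [minLagrangian_of_ge (by nlinarith [hy.2]) (by nlinarith [hy.1])]
      ring
    have e2 : ∫ y in (0 : ℝ)..1, legendreThree y * minLagrangian Wub γ (γ + ρ * y) =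
        ∫ y in (0 : ℝ)..1, legendreThree y * (-(γ ^ 2 / 2) + 0 * y + ρ ^ 2 / 2 * y ^ 2) := by
      refine intervalIntegral.integral_congr fun y hy => ?_
      rw [Set.uIcc_of_le (by norm_num)] at hy
      rw [minLagrangian_of_le (by nlinarith [hy.1]), lagrangian]
      ring
    rw [← intervalIntegral.integral_add_adjacent_intervals (hcont.intervalIntegrable (-1) 0)
      (hcont.intervalIntegrable 0 1), e1, e2, integral_legendreThree_mul_quadratic,
      integral_legendreThree_mul_quadratic]
    -- On the window the least Lagrangian is -γ²/2 plus (x - γ)²/2 to the right of γ only. This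
    -- one-sided square is not orthogonal to the cubic: ∫₀¹ (5y³ - 3y) y² dy = 1/12.
    have : 0 < c / 8 * (ρ * (ρ ^ 2 / 24)) := by positivity
    convert this using 3
    ring

end Score

/-! ### Moments of the gamma law. -/

section Gamma

lemma integral_pow_gammaMeasure {a r : ℝ} (ha : 0 < a) (hr : 0 < r) (n : ℕ) :
    Integrable (fun x => x ^ n) (gammaMeasure a r) ∧
      ∫ x, x ^ n ∂(gammaMeasure a r) = Real.Gamma (a + n) / (Real.Gamma a * r ^ n) := by
  have hG := Real.Gamma_pos_of_pos ha
  have hG' := Real.Gamma_pos_of_pos (by positivity : 0 < a + n)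
  have h : ∫ x, x ^ n ∂(gammaMeasure a r) = Real.Gamma (a + n) / (Real.Gamma a * r ^ n) := by
    have hpdf : Measurable (gammaPDF a r) := (measurable_gammaPDFReal a r).ennreal_ofReal
    rw [gammaMeasure, integral_withDensity_eq_integral_toReal_smul hpdf (by simp [gammaPDF])]
    have e : (fun x => (gammaPDF a r x).toReal • x ^ n) = (Set.Ici 0).indicator
        fun x => r ^ a / Real.Gamma a * (x ^ (a - 1) * Real.exp (-(r * x)) * x ^ n) := by
      ext x
      rw [gammaPDF, ENNReal.toReal_ofReal (gammaPDFReal_nonneg ha hr x), gammaPDFReal]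
      by_cases hx : 0 ≤ x
      · simp only [hx, if_true, smul_eq_mul, Set.indicator_of_mem (Set.mem_Ici.2 hx)]
        ring
      · simp only [hx, if_false, zero_smul, Set.indicator_of_notMem (fun h => hx (Set.mem_Ici.1 h))]
    rw [e, integral_indicator measurableSet_Ici, integral_Ici_eq_integral_Ioi, integral_const_mul]
    have e2 : ∫ x in Set.Ioi (0 : ℝ), x ^ (a - 1) * Real.exp (-(r * x)) * x ^ n =
        ∫ x in Set.Ioi (0 : ℝ), x ^ (a + n - 1) * Real.exp (-(r * x)) := by
      refine setIntegral_congr_fun measurableSet_Ioi fun x hx => ?_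
      rw [add_sub_right_comm, Real.rpow_add_natCast (ne_of_gt hx)]
      ring
    rw [e2, Real.integral_rpow_mul_exp_neg_mul_Ioi (by positivity) hr, one_div,
      Real.inv_rpow hr.le, Real.rpow_add_natCast hr.ne']
    have := Real.rpow_pos_of_pos hr a
    field_simp
  refine ⟨?_, h⟩
  -- A nonintegrable function has Bochner integral 0, so the positive value just computed proves
  -- integrability.
  refine Integrable.of_integral_ne_zero ?_
  rw [h]
  positivity

lemma continuousOn_gammaPDFReal (a r : ℝ) : ContinuousOn (gammaPDFReal a r) (Set.Ioi 0) := by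
  have : ContinuousOn (fun x : ℝ => r ^ a / Real.Gamma a * x ^ (a - 1) * Real.exp (-(r * x)))
      (Set.Ioi 0) := by
    refine (continuousOn_const.mul (continuousOn_id.rpow_const fun x hx => Or.inl ?_)).mul
      (by fun_prop)
    exact ne_of_gt hx
  refine this.congr fun x hx => ?_
  rw [gammaPDFReal, if_pos (le_of_lt hx)]

lemma ae_nonneg_gammaMeasure (a r : ℝ) : ∀ᵐ x ∂(gammaMeasure a r), 0 ≤ x := by
  rw [ae_iff, gammaMeasure]
  have : {x : ℝ | ¬ 0 ≤ x} = Set.Iio 0 := by ext; simp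
  rw [this, withDensity_apply _ measurableSet_Iio, setLIntegral_congr_fun measurableSet_Iio
    (fun x hx => gammaPDF_of_neg hx), lintegral_zero]

lemma gammaMeasure_absolutelyContinuous (a r : ℝ) : gammaMeasure a r ≪ volume :=
  withDensity_absolutelyContinuous _ _

end Gamma

/-! ### Lower bound for estimating the threshold. -/

/-- The minimax lower bound `c / k` for the estimation of the optimal threshold. -/
theorem exists_minimax_threshold_bound {Wub : ℝ} (hW : 0 < Wub) {Dlb Dub Mlb Mub : ℝ}
    (hD : 0 < Dlb) (hDD : Dlb ≤ Dub) (hMM : Mlb ≤ Mub) (hDM : Dlb ^ 2 < Mub) :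
    ∃ c : ℝ, 0 < c ∧ ∀ a₀ : ℝ, 0 ≤ a₀ → ∀ k : ℕ, 1 ≤ k →
      ENNReal.ofReal (c / (k : ℝ)) ≤
        ⨅ (γhat : (Fin k → ℝ) → ℝ) (_ : Measurable γhat),
          ⨆ P ∈ momentClass Dlb Dub Mlb Mub,
            ∫⁻ h, ENNReal.ofReal ((γhat h - optimalThreshold a₀ Wub P) ^ 2)
              ∂(Measure.pi (fun _ : Fin k => (P : Measure ℝ))) := by
  have hv : 0 < Mub - Dlb ^ 2 := sub_pos.2 hDM
  -- Shape and rate are chosen to give mean `Dlb` and second moment `Mub`, the one corner of the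
  -- class that `Dlb ^ 2 < Mub` guarantees to be feasible.
  set a := Dlb ^ 2 / (Mub - Dlb ^ 2) with ha
  set r := Dlb / (Mub - Dlb ^ 2) with hr
  have ha0 : 0 < a := by positivity
  have hr0 : 0 < r := by positivity
  have := isProbabilityMeasure_gammaMeasure ha0 hr0
  have hG := Real.Gamma_pos_of_pos ha0
  obtain ⟨i1, m1⟩ := integral_pow_gammaMeasure ha0 hr0 1
  obtain ⟨i2, m2⟩ := integral_pow_gammaMeasure ha0 hr0 2
  have hm1 : ∫ x, x ∂(gammaMeasure a r) = Dlb := by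
    simp only [pow_one, Nat.cast_one] at m1
    rw [m1, Real.Gamma_add_one ha0.ne', ha, hr]
    rw [ha] at hG
    field_simp
  have hm2 : ∫ x, x ^ 2 ∂(gammaMeasure a r) = Mub := by
    have e : a + ((2 : ℕ) : ℝ) = (a + 1) + 1 := by push_cast; ring
    rw [m2, e, Real.Gamma_add_one (by positivity), Real.Gamma_add_one ha0.ne']
    have : (a + 1) * (a * Real.Gamma a) / (Real.Gamma a * r ^ 2) = (a + 1) * a / r ^ 2 := by
      field_simp
    rw [this, ha, hr]
    field_simp
    ring
  simp only [pow_one] at i1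
  have hac := gammaMeasure_absolutelyContinuous a r
  have hQ : IsDelayLaw (gammaMeasure a r) := ⟨ae_nonneg_gammaMeasure a r, i2, hm1 ▸ hD⟩
  obtain ⟨γ₀, hγ₀, hroot⟩ := hQ.exists_expMinLagrangian_eq_zero hW.le
  obtain ⟨s, hs, hs1, hs2, hs3⟩ : ∃ s, IsScore (gammaMeasure a r) s ∧
      ∫ x, s x * x ∂(gammaMeasure a r) = 0 ∧ ∫ x, s x * x ^ 2 ∂(gammaMeasure a r) = 0 ∧
      0 < ∫ x, s x * minLagrangian Wub γ₀ x ∂(gammaMeasure a r) :=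
    exists_score (measurable_gammaPDFReal a r) (gammaPDFReal_nonneg ha0 hr0)
      (continuousOn_gammaPDFReal a r) (fun x hx => gammaPDFReal_pos ha0 hr0 hx) hW hγ₀
  set κ := ∫ x, s x * minLagrangian Wub γ₀ x ∂(gammaMeasure a r) with hκ
  have hmem : ∀ θ, hs.law θ ∈ momentClass Dlb Dub Mlb Mub := fun θ => by
    refine ⟨(hs.law_absolutelyContinuous θ).trans hac,
      (hs.law_absolutelyContinuous θ).ae_le hQ.nonneg, hs.integrable_law i2 θ, ?_, ?_⟩
    · rw [hs.integral_law i1, hs1, hm1]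
      simpa using hDD
    · rw [hs.integral_law i2, hs2, hm2]
      simpa using hMM
  have hlaw : ∀ θ, IsDelayLaw (hs.law θ : Measure ℝ) := hs.isDelayLaw hac hQ
  have hmean : ∀ θ, ∫ x, x ∂(hs.law θ : Measure ℝ) = Dlb := fun θ => by
    rw [hs.integral_law i1, hs1, hm1, mul_zero, add_zero]
  choose γ _ hγ using fun θ => (hlaw θ).exists_expMinLagrangian_eq_zero hW.le
  refine ⟨(κ / (Dlb + Wub)) ^ 2 / 16, by positivity, fun a₀ _ k hk => ?_⟩
  refine le_iInf₂ fun γhat hγhat => ?_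
  have hk0 : (1 : ℝ) ≤ k := by exact_mod_cast hk
  -- The largest separation that the two-point bound allows with k samples.
  set ε := 1 / Real.sqrt (8 * k) with hε
  have hε0 : 0 < ε := by positivity
  have hεsq : ε ^ 2 = 1 / (8 * k) := by
    rw [hε, div_pow, Real.sq_sqrt (by positivity), one_pow]
  have hεhalf : |ε| ≤ 1 / 2 := by
    refine abs_le_of_sq_le_sq ?_ (by norm_num)
    rw [hεsq, div_le_iff₀ (by positivity)]
    linarith
  have hgap1 : ε * κ / (Dlb + Wub) ≤ γ (0 + ε) - γ₀ := by
    have hv : expMinLagrangian Wub (hs.law (0 + ε) : Measure ℝ) γ₀ = ε * κ := by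
      rw [hs.expMinLagrangian_law hQ hW.le, hroot, zero_add, zero_add,
        clampUnit_of_abs_le (hεhalf.trans (by norm_num))]
    have := (hlaw (0 + ε)).root_gap hW.le (γ := γ (0 + ε)) (γ' := γ₀)
      (by rw [hγ, hv]; positivity)
    rwa [hγ, hv, hmean, sub_zero] at this
  have hgap2 : ε * κ / (Dlb + Wub) ≤ γ₀ - γ (0 - ε) := by
    have hv : expMinLagrangian Wub (hs.law (0 - ε) : Measure ℝ) γ₀ = -(ε * κ) := by
      rw [hs.expMinLagrangian_law hQ hW.le, hroot, zero_sub, zero_add,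
        clampUnit_of_abs_le (by rw [abs_neg]; exact hεhalf.trans (by norm_num)), neg_mul]
    have := (hlaw (0 - ε)).root_gap hW.le (γ := γ₀) (γ' := γ (0 - ε))
      (by rw [hγ, hv, neg_lt_zero]; positivity)
    rwa [hγ, hv, hmean, zero_sub, neg_neg] at this
  have h2 := hs.two_point hγhat ⟨0, hk⟩ MeasurableSet.univ (θ := 0) (ε := ε) (by simp)
    (by rw [hεsq]; field_simp; rfl) hεhalf (γ (0 - ε)) (γ (0 + ε))
  simp only [Set.indicator_univ, Pi.one_apply, one_mul, probReal_univ, mul_one] at h2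
  set S := ⨆ P ∈ momentClass Dlb Dub Mlb Mub,
            ∫⁻ h, ENNReal.ofReal ((γhat h - optimalThreshold a₀ Wub P) ^ 2)
              ∂(Measure.pi (fun _ : Fin k => (P : Measure ℝ))) with hS
  have hle : ∀ θ, ∫⁻ x, ENNReal.ofReal ((γhat x - γ θ) ^ 2)
      ∂(Measure.pi fun _ : Fin k => (hs.law θ : Measure ℝ)) ≤ S := fun θ => by
    rw [← optimalThreshold_eq (hlaw θ) hW.le a₀ (hγ θ)]
    exact le_iSup₂_of_le (hs.law θ) (hmem θ) le_rfl
  have h3 := h2.trans (add_le_add (hle _) (hle _))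
  rw [← two_mul] at h3
  have h4 : ENNReal.ofReal 2 * ENNReal.ofReal ((κ / (Dlb + Wub)) ^ 2 / 16 / k) ≤
      ENNReal.ofReal ((γ (0 - ε) - γ (0 + ε)) ^ 2 / 4) := by
    rw [← ENNReal.ofReal_mul (by norm_num)]
    refine ENNReal.ofReal_le_ofReal ?_
    have h5 : 0 ≤ ε * κ / (Dlb + Wub) := by positivity
    have h6 : (2 * (ε * κ / (Dlb + Wub))) ^ 2 ≤ (γ (0 - ε) - γ (0 + ε)) ^ 2 := by
      rw [← neg_sq (γ (0 - ε) - _)]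
      exact pow_le_pow_left₀ (by positivity) (by linarith) 2
    have h7 : (2 * (ε * κ / (Dlb + Wub))) ^ 2 = 4 * (1 / (8 * k)) * (κ / (Dlb + Wub)) ^ 2 := by
      rw [← hεsq]; ring
    rw [h7] at h6
    refine le_trans (le_of_eq ?_) (div_le_div_of_nonneg_right h6 (by norm_num))
    field_simp
    norm_num
  have h8 := h4.trans h3
  rw [show ENNReal.ofReal 2 = 2 by simp] at h8
  exact (ENNReal.mul_le_mul_iff_right (by norm_num) (by norm_num)).1 h8

/-! ### The two-band law and its thresholds. -/

section BandLaw

/-- The short delays of the two-band law. -/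
def lowBand (b : ℝ) : Set ℝ := Set.Icc 0 (b / 8)

/-- The long delays of the two-band law. -/
def highBand (b : ℝ) : Set ℝ := Set.Icc (7 * b / 8) b

/-- The uniform law on the two bands. -/
noncomputable def bandLaw (b : ℝ) : Measure ℝ := cond volume (lowBand b ∪ highBand b)

/-- The score that shifts mass from the long to the short delays. -/
noncomputable def bandScore (b : ℝ) (x : ℝ) : ℝ :=
  (lowBand b).indicator 1 x - (highBand b).indicator 1 x

lemma measurableSet_lowBand (b : ℝ) : MeasurableSet (lowBand b) := measurableSet_Icc

lemma measurableSet_highBand (b : ℝ) : MeasurableSet (highBand b) := measurableSet_Icc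

lemma bandLaw_absolutelyContinuous (b : ℝ) : bandLaw b ≪ volume := cond_absolutelyContinuous

lemma ae_mem_bands (b : ℝ) : ∀ᵐ x ∂(bandLaw b), x ∈ lowBand b ∪ highBand b :=
  ae_cond_mem ((measurableSet_lowBand b).union (measurableSet_highBand b))

variable {b : ℝ} (hb : 0 < b)
include hb

lemma disjoint_bands : Disjoint (lowBand b) (highBand b) :=
  Set.disjoint_left.2 fun x h1 h2 => by linarith [h1.2, h2.1]

omit hb in
lemma volume_lowBand : volume (lowBand b) = ENNReal.ofReal (b / 8) := by
  rw [lowBand, Real.volume_Icc, sub_zero]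

omit hb in
lemma volume_highBand : volume (highBand b) = ENNReal.ofReal (b / 8) := by
  rw [highBand, Real.volume_Icc]; congr 1; ring

lemma volume_bands : volume (lowBand b ∪ highBand b) = ENNReal.ofReal (b / 4) := by
  rw [measure_union (disjoint_bands hb) (measurableSet_highBand b), volume_lowBand,
    volume_highBand, ← ENNReal.ofReal_add (by positivity) (by positivity)]
  congr 1; ring

lemma isProbabilityMeasure_bandLaw : IsProbabilityMeasure (bandLaw b) := by
  refine cond_isProbabilityMeasure_of_finite ?_ ?_
  · rw [volume_bands hb]; simpa using hb
  · rw [volume_bands hb]; exact ENNReal.ofReal_ne_top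

lemma bandLaw_real_of_subset {s : Set ℝ} (hs : s ⊆ lowBand b ∪ highBand b)
    (hv : volume s = ENNReal.ofReal (b / 8)) : (bandLaw b).real s = 1 / 2 := by
  rw [measureReal_def, bandLaw,
    cond_apply ((measurableSet_lowBand b).union (measurableSet_highBand b)),
    Set.inter_eq_self_of_subset_right hs, hv, volume_bands hb, ENNReal.toReal_mul,
    ENNReal.toReal_inv, ENNReal.toReal_ofReal (by positivity), ENNReal.toReal_ofReal (by positivity)]
  field_simp
  norm_num

lemma bandLaw_real_lowBand : (bandLaw b).real (lowBand b) = 1 / 2 :=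
  bandLaw_real_of_subset hb Set.subset_union_left (volume_lowBand)

lemma bandLaw_real_highBand : (bandLaw b).real (highBand b) = 1 / 2 :=
  bandLaw_real_of_subset hb Set.subset_union_right volume_highBand

lemma bandScore_of_mem_low {x : ℝ} (hx : x ∈ lowBand b) : bandScore b x = 1 := by
  simp [bandScore, hx, Set.disjoint_left.1 (disjoint_bands hb) hx]

lemma bandScore_of_mem_high {x : ℝ} (hx : x ∈ highBand b) : bandScore b x = -1 := by
  simp [bandScore, hx, Set.disjoint_right.1 (disjoint_bands hb) hx]

lemma isScore_bandScore : IsScore (bandLaw b) (bandScore b) := by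
  have := isProbabilityMeasure_bandLaw hb
  refine ⟨(measurable_one.indicator (measurableSet_lowBand b)).sub
    (measurable_one.indicator (measurableSet_highBand b)), fun x => ?_, ?_⟩
  · by_cases h1 : x ∈ lowBand b
    · simp [bandScore_of_mem_low hb h1]
    · by_cases h2 : x ∈ highBand b
      · simp [bandScore_of_mem_high hb h2]
      · simp [bandScore, h1, h2]
  · have hi : ∀ s : Set ℝ, MeasurableSet s →
        Integrable (s.indicator (1 : ℝ → ℝ)) (bandLaw b) := fun s hs =>
      (integrable_indicator_iff hs).2 (integrable_const 1).integrableOn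
    unfold bandScore
    rw [integral_sub (hi _ (measurableSet_lowBand b)) (hi _ (measurableSet_highBand b)),
      integral_indicator_one (measurableSet_lowBand b),
      integral_indicator_one (measurableSet_highBand b), bandLaw_real_lowBand hb,
      bandLaw_real_highBand hb, sub_self]

lemma ae_bandLaw_mem_Icc : ∀ᵐ x ∂(bandLaw b), 0 ≤ x ∧ x ≤ b := by
  filter_upwards [ae_mem_bands b] with x hx
  rcases hx with hx | hx
  · exact ⟨hx.1, by linarith [hx.2]⟩
  · exact ⟨by linarith [hx.1], hx.2⟩

lemma isDelayLaw_bandLaw : IsDelayLaw (bandLaw b) := by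
  have := isProbabilityMeasure_bandLaw hb
  refine .of_absolutelyContinuous (bandLaw_absolutelyContinuous b)
    ((ae_bandLaw_mem_Icc hb).mono fun x hx => hx.1) ?_
  refine (integrable_const (b ^ 2)).mono' (by fun_prop) ((ae_bandLaw_mem_Icc hb).mono fun x hx => ?_)
  rw [Real.norm_of_nonneg (sq_nonneg x)]
  exact pow_le_pow_left₀ hx.1 hx.2 2

/-- The two-band law tilted towards the short delays by `θ`. -/
noncomputable def tiltedBandLaw (θ : ℝ) : ProbabilityMeasure ℝ :=
  have := isProbabilityMeasure_bandLaw hb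
  (isScore_bandScore hb).law θ

lemma tiltedBandLaw_absolutelyContinuous (θ : ℝ) : (tiltedBandLaw hb θ : Measure ℝ) ≪ bandLaw b :=
  have := isProbabilityMeasure_bandLaw hb
  (isScore_bandScore hb).law_absolutelyContinuous θ

lemma isDelayLaw_tiltedBandLaw (θ : ℝ) : IsDelayLaw (tiltedBandLaw hb θ : Measure ℝ) :=
  have := isProbabilityMeasure_bandLaw hb
  (isScore_bandScore hb).isDelayLaw (bandLaw_absolutelyContinuous b) (isDelayLaw_bandLaw hb) θ

lemma ae_tiltedBandLaw_mem_Icc (θ : ℝ) : ∀ᵐ x ∂(tiltedBandLaw hb θ : Measure ℝ), 0 ≤ x ∧ x ≤ b :=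
  (tiltedBandLaw_absolutelyContinuous hb θ).ae_le (ae_bandLaw_mem_Icc hb)

lemma tiltedBandLaw_mean_le (θ : ℝ) : ∫ x, x ∂(tiltedBandLaw hb θ : Measure ℝ) ≤ b := by
  calc _ ≤ ∫ _, b ∂(tiltedBandLaw hb θ : Measure ℝ) :=
        integral_mono_ae (isDelayLaw_tiltedBandLaw hb θ).integrable (integrable_const _)
          ((ae_tiltedBandLaw_mem_Icc hb θ).mono fun x hx => hx.2)
    _ = b := by simp

lemma tiltedBandLaw_real {θ : ℝ} (hθ : |θ| ≤ 1) :
    (tiltedBandLaw hb θ : Measure ℝ).real (lowBand b) = (1 + θ) / 2 ∧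
    (tiltedBandLaw hb θ : Measure ℝ).real (highBand b) = (1 - θ) / 2 := by
  have := isProbabilityMeasure_bandLaw hb
  have key : ∀ s : Set ℝ, MeasurableSet s → ∀ c : ℝ, (∀ x ∈ s, bandScore b x = c) →
      (tiltedBandLaw hb θ : Measure ℝ).real s = (1 + c * θ) * (bandLaw b).real s := by
    intro s hs c hc
    rw [← integral_indicator_one hs, ← integral_indicator_one hs, tiltedBandLaw,
      (isScore_bandScore hb).integral_law (f := s.indicator 1)
        ((integrable_indicator_iff hs).2 (integrable_const 1).integrableOn),
      clampUnit_of_abs_le hθ]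
    have e : (fun x => bandScore b x * s.indicator 1 x) = fun x => c * s.indicator 1 x := by
      ext x
      by_cases hx : x ∈ s
      · rw [hc x hx]
      · simp [hx]
    rw [e, integral_const_mul]
    ring
  rw [key _ (measurableSet_lowBand b) 1 fun x => bandScore_of_mem_low hb,
    key _ (measurableSet_highBand b) (-1) fun x => bandScore_of_mem_high hb,
    bandLaw_real_lowBand hb, bandLaw_real_highBand hb]
  constructor <;> ring

variable {Wub : ℝ} (hbW : b ≤ Wub)
include hbW

/-- The least Lagrangian is -γ²/2 on the low band and exceeds that by (x - γ)²/2 ≥ (3b/8)²/2 on the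
high band. The constant part integrates to zero against the score; the excess has weight -1 and mass
1/2. -/
lemma integral_bandScore_mul_minLagrangian_le {γ : ℝ} (h1 : b / 8 ≤ γ) (h2 : γ ≤ b / 2) :
    ∫ x, bandScore b x * minLagrangian Wub γ x ∂(bandLaw b) ≤ -(b ^ 2 / 32) := by
  have := isProbabilityMeasure_bandLaw hb
  have hs := isScore_bandScore hb
  have hi : Integrable ((highBand b).indicator (1 : ℝ → ℝ)) (bandLaw b) :=
    (integrable_indicator_iff (measurableSet_highBand b)).2 (integrable_const 1).integrableOn
  have hsi : Integrable (bandScore b) (bandLaw b) := by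
    simpa using hs.integrable_mul (integrable_const (1 : ℝ))
  calc _ ≤ ∫ x, (-(γ ^ 2 / 2)) * bandScore b x + (-(9 / 128 * b ^ 2)) * (highBand b).indicator 1 x
        ∂(bandLaw b) := by
        refine integral_mono_ae (hs.integrable_mul
          ((isDelayLaw_bandLaw hb).integrable_minLagrangian (hb.le.trans hbW) γ))
          ((hsi.const_mul _).add (hi.const_mul _)) ?_
        filter_upwards [ae_mem_bands b] with x hx
        rcases hx with hx | hx
        · rw [bandScore_of_mem_low hb hx, minLagrangian_of_ge (hx.2.trans h1) (by linarith [hx.1]),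
            Set.indicator_of_notMem (Set.disjoint_left.1 (disjoint_bands hb) hx)]
          linarith
        · rw [bandScore_of_mem_high hb hx, minLagrangian_of_le (by linarith [hx.1]),
            Set.indicator_of_mem hx, lagrangian]
          have hx1 := hx.1
          simp only [Pi.one_apply]
          nlinarith
    _ = -(9 / 256 * b ^ 2) := by
        rw [integral_add (hsi.const_mul _) (hi.const_mul _), integral_const_mul,
          integral_const_mul, hs.integral_eq_zero,
          integral_indicator_one (measurableSet_highBand b), bandLaw_real_highBand hb]
        ring
    _ ≤ _ := by nlinarith

/-- The optimal thresholds lie between the two bands. -/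
lemma threshold_mem_of_root {θ : ℝ} (hθ : |θ| ≤ 1 / 2) {γ : ℝ}
    (hγ : expMinLagrangian Wub (tiltedBandLaw hb θ : Measure ℝ) γ = 0) :
    b / 8 ≤ γ ∧ γ ≤ b / 2 := by
  have hP := isDelayLaw_tiltedBandLaw hb θ
  have hW := hb.le.trans hbW
  have hanti := hP.strictAnti_expMinLagrangian hW
  constructor
  · rw [← hanti.le_iff_ge, hγ]
    have hi : Integrable ((highBand b).indicator (1 : ℝ → ℝ)) (tiltedBandLaw hb θ : Measure ℝ) :=
      (integrable_indicator_iff (measurableSet_highBand b)).2 (integrable_const 1).integrableOn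
    calc (0 : ℝ) ≤ -(b ^ 2 / 128) + b ^ 2 / 4 * ((1 - θ) / 2) := by
          nlinarith [(abs_le.1 hθ).2, sq_nonneg b]
      _ = ∫ x, (-(b ^ 2 / 128) + b ^ 2 / 4 * (highBand b).indicator 1 x)
            ∂(tiltedBandLaw hb θ : Measure ℝ) := by
          rw [integral_add (integrable_const _) (hi.const_mul _), integral_const_mul,
            integral_indicator_one (measurableSet_highBand b),
            (tiltedBandLaw_real hb (hθ.trans (by norm_num))).2]
          simp
      _ ≤ _ := by
          refine integral_mono ((integrable_const _).add (hi.const_mul _))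
            (hP.integrable_minLagrangian hW _) fun x => ?_
          simp only
          by_cases hx : x ∈ highBand b
          · have hx1 := hx.1
            rw [minLagrangian_of_le (by linarith [hx.1]), Set.indicator_of_mem hx, lagrangian,
              Pi.one_apply]
            nlinarith
          · rw [Set.indicator_of_notMem hx]
            refine le_trans (le_of_eq ?_) (neg_sq_le_minLagrangian Wub (b / 8) x)
            ring
  · rw [← hanti.le_iff_ge, hγ]
    refine integral_nonpos_of_ae ((ae_tiltedBandLaw_mem_Icc hb θ).mono fun x hx => ?_)
    -- Not waiting already gives x(x - b)/2 ≤ 0 at the price b/2.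
    refine (minLagrangian_le _ le_rfl (by linarith)).trans ?_
    rw [lagrangian, Pi.zero_apply]
    nlinarith [hx.1, hx.2]

/-- The expected least Lagrangian is affine in θ. At the root for θ its value under θ' is therefore
θ' - θ times the score integral, which `root_gap` converts into a distance between roots. -/
lemma tiltedBandLaw_root_gap {θ θ' γ γ' : ℝ} (hθ : |θ| ≤ 1 / 2) (hθ' : |θ'| ≤ 1 / 2)
    (h : θ < θ') (hγ : expMinLagrangian Wub (tiltedBandLaw hb θ : Measure ℝ) γ = 0)
    (hγ' : expMinLagrangian Wub (tiltedBandLaw hb θ' : Measure ℝ) γ' = 0) :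
    b ^ 2 / 32 / (b + Wub) * (θ' - θ) ≤ γ - γ' := by
  have := isProbabilityMeasure_bandLaw hb
  have hW := hb.le.trans hbW
  have hQ := isDelayLaw_bandLaw hb
  have hs := isScore_bandScore hb
  have hmem := threshold_mem_of_root hb hbW hθ hγ
  have hint := integral_bandScore_mul_minLagrangian_le hb hbW hmem.1 hmem.2
  have e1 := hs.expMinLagrangian_law hQ hW θ γ
  have e2 := hs.expMinLagrangian_law hQ hW θ' γ
  rw [clampUnit_of_abs_le (by linarith)] at e1 e2
  change expMinLagrangian Wub (tiltedBandLaw hb θ : Measure ℝ) γ = _ at e1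
  change expMinLagrangian Wub (tiltedBandLaw hb θ' : Measure ℝ) γ = _ at e2
  have hval : expMinLagrangian Wub (tiltedBandLaw hb θ' : Measure ℝ) γ ≤
      -(b ^ 2 / 32 * (θ' - θ)) := by nlinarith
  have hpos : 0 < b ^ 2 / 32 * (θ' - θ) := mul_pos (by positivity) (sub_pos.2 h)
  have hP := isDelayLaw_tiltedBandLaw hb θ'
  have hgap := hP.root_gap hW (γ := γ) (γ' := γ') (by rw [hγ']; linarith)
  have hm := tiltedBandLaw_mean_le hb θ'
  refine le_trans ?_ hgap
  rw [hγ', zero_sub, div_mul_eq_mul_div]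
  have hm0 := hP.mean_pos
  exact div_le_div₀ (by linarith) (by linarith) (by linarith) (by linarith)

/-- The weighted squared error of the cycle length as an estimate of the threshold is bounded by
the excess Lagrangian. -/
lemma lintegral_sq_le_lagrangian {θ γ : ℝ} (hθ : |θ| ≤ 1 / 2)
    (hγ : expMinLagrangian Wub (tiltedBandLaw hb θ : Measure ℝ) γ = 0) (π : CausalPolicy Wub)
    (i : ℕ) :
    ∫⁻ ω, (lowBand b).indicator 1 (ω.2 i) * ENNReal.ofReal ((π.cycle ω.1 ω.2 i - γ) ^ 2)
      ∂(seedDelayLaw (tiltedBandLaw hb θ)) ≤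
    ENNReal.ofReal (2 * ∫ ω, lagrangian γ (π.cycle ω.1 ω.2 i)
      ∂(seedDelayLaw (tiltedBandLaw hb θ))) := by
  have hW := hb.le.trans hbW
  have hP := isDelayLaw_tiltedBandLaw hb θ
  have hmem := threshold_mem_of_root hb hbW hθ hγ
  have hd := measurePreserving_delay (tiltedBandLaw hb θ) i
  have h0 : ∫ ω : I × (ℕ → ℝ), minLagrangian Wub γ (ω.2 i)
      ∂(seedDelayLaw (tiltedBandLaw hb θ)) = 0 := by
    rw [← hγ, expMinLagrangian, ← hd.map_eq, integral_map hd.aemeasurable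
      (continuous_minLagrangian Wub γ).aestronglyMeasurable]
  have hi0 : Integrable (fun ω : I × (ℕ → ℝ) => minLagrangian Wub γ (ω.2 i))
      (seedDelayLaw (tiltedBandLaw hb θ)) :=
    hd.integrable_comp_of_integrable (hP.integrable_minLagrangian hW γ)
  have hi1 := π.integrable_lagrangian_cycle hP γ i
  have hnn : ∀ ω : I × (ℕ → ℝ),
      0 ≤ lagrangian γ (π.cycle ω.1 ω.2 i) - minLagrangian Wub γ (ω.2 i) := fun ω =>
    sub_nonneg.2 (minLagrangian_le γ (π.le_cycle _ _ _) (π.cycle_le _ _ _))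
  have e : ∫ ω, lagrangian γ (π.cycle ω.1 ω.2 i) ∂(seedDelayLaw (tiltedBandLaw hb θ)) =
      ∫ ω, (lagrangian γ (π.cycle ω.1 ω.2 i) - minLagrangian Wub γ (ω.2 i))
        ∂(seedDelayLaw (tiltedBandLaw hb θ)) := by
    rw [integral_sub hi1 hi0, h0, sub_zero]
  have hi2 : Integrable (fun ω : I × (ℕ → ℝ) =>
      2 * (lagrangian γ (π.cycle ω.1 ω.2 i) - minLagrangian Wub γ (ω.2 i)))
      (seedDelayLaw (tiltedBandLaw hb θ)) := (hi1.sub hi0).const_mul 2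
  rw [e, ← integral_const_mul, ofReal_integral_eq_lintegral_ofReal hi2
    (ae_of_all _ fun ω => mul_nonneg zero_le_two (hnn ω))]
  refine lintegral_mono fun ω => ?_
  -- After a short delay the threshold is reachable, so twice the excess is exactly the squared
  -- error. After other delays nonnegativity suffices.
  by_cases hω : ω.2 i ∈ lowBand b
  · simp only [Set.indicator_of_mem hω, Pi.one_apply, one_mul]
    refine ENNReal.ofReal_le_ofReal (le_of_eq ?_)
    rw [minLagrangian_of_ge (hω.2.trans hmem.1) (by linarith [hω.1, hmem.2]), lagrangian]
    ring
  · simp [hω]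

/-- Two-point bound for the error of the cycle length as an estimate of the threshold. -/
lemma two_point_cycle (π : CausalPolicy Wub) (i : ℕ) {θ ε γ γ' : ℝ} (hθ : |θ| ≤ 1 / 4)
    (hε0 : 0 < ε) (hε : ε ≤ 1 / 4) (hεi : 8 * ((i + 1 : ℕ) : ℝ) * ε ^ 2 ≤ 1)
    (hγ : expMinLagrangian Wub (tiltedBandLaw hb (θ - ε) : Measure ℝ) γ = 0)
    (hγ' : expMinLagrangian Wub (tiltedBandLaw hb (θ + ε) : Measure ℝ) γ' = 0) :
    ENNReal.ofReal ((b ^ 2 / 32 / (b + Wub) * ε) ^ 2 / 4) ≤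
    (∫⁻ ω, (lowBand b).indicator 1 (ω.2 i) * ENNReal.ofReal ((π.cycle ω.1 ω.2 i - γ) ^ 2)
      ∂(seedDelayLaw (tiltedBandLaw hb (θ - ε)))) +
    ∫⁻ ω, (lowBand b).indicator 1 (ω.2 i) * ENNReal.ofReal ((π.cycle ω.1 ω.2 i - γ') ^ 2)
      ∂(seedDelayLaw (tiltedBandLaw hb (θ + ε))) := by
  have := isProbabilityMeasure_bandLaw hb
  have hθ' := abs_le.1 hθ
  have hcyc := π.measurable_cycleOfHistory i
  have hF : ∀ g : ℝ, Measurable fun z : I × (Fin (i + 1) → ℝ) =>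
      (lowBand b).indicator (1 : ℝ → ℝ≥0∞) (z.2 (Fin.last i)) *
        ENNReal.ofReal ((π.cycleOfHistory i z - g) ^ 2) := fun g =>
    ((measurable_one.indicator (measurableSet_lowBand b)).comp
      ((measurable_pi_apply _).comp measurable_snd)).mul
      ((hcyc.sub_const g).pow_const 2).ennreal_ofReal
  have hL : ∀ (P : ProbabilityMeasure ℝ) (g : ℝ),
      ∫⁻ ω, (lowBand b).indicator 1 (ω.2 i) * ENNReal.ofReal ((π.cycle ω.1 ω.2 i - g) ^ 2)
        ∂(seedDelayLaw P) = ∫⁻ u : I, ∫⁻ h : Fin (i + 1) → ℝ,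
          (lowBand b).indicator 1 (h (Fin.last i)) *
            ENNReal.ofReal ((π.cycleOfHistory i (u, h) - g) ^ 2)
          ∂(Measure.pi fun _ => (P : Measure ℝ)) := fun P g => by
    rw [← lintegral_prod _ (hF g).aemeasurable,
      ← (measurePreserving_history P (i + 1)).lintegral_comp (hF g)]
    rfl
  rw [hL, hL, ← lintegral_add_left (hF γ).lintegral_prod_right']
  have hgap := tiltedBandLaw_root_gap hb hbW (θ := θ - ε) (θ' := θ + ε)
    (abs_le.2 (by constructor <;> linarith)) (abs_le.2 (by constructor <;> linarith))
    (by linarith) hγ hγ'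
  have hW := hb.trans_le hbW
  have hmass := (tiltedBandLaw_real hb (hθ.trans (by norm_num))).1
  -- For a frozen seed the cycle length is a deterministic function of the delays, so the two-point
  -- bound applies seed by seed and is then averaged.
  refine le_trans ?_ (lintegral_mono (μ := (volume : Measure I))
    fun u => (isScore_bandScore hb).two_point
    (f := fun h => π.cycleOfHistory i (u, h)) (by fun_prop) (Fin.last i)
    (measurableSet_lowBand b) (θ := θ) (ε := ε) (hθ.trans (by norm_num)) hεi
    (by rw [abs_of_pos hε0]; linarith) γ γ')
  rw [lintegral_const, measure_univ, mul_one]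
  refine ENNReal.ofReal_le_ofReal ?_
  change _ ≤ _ * (tiltedBandLaw hb θ : Measure ℝ).real (lowBand b)
  rw [hmass]
  have h0 : 0 ≤ b ^ 2 / 32 / (b + Wub) * ε := by positivity
  have h1 : (2 * (b ^ 2 / 32 / (b + Wub) * ε)) ^ 2 ≤ (γ - γ') ^ 2 :=
    pow_le_pow_left₀ (by positivity) (by linarith) 2
  have h2 : (γ - γ') ^ 2 / 4 * (1 / 4) ≤ (γ - γ') ^ 2 / 4 * ((1 + θ) / 2) :=
    mul_le_mul_of_nonneg_left (by linarith) (by positivity)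
  nlinarith [sq_nonneg (b ^ 2 / 32 / (b + Wub) * ε)]

end BandLaw

/-! ### Averaging over a prior and the logarithmic sum. -/

lemma setLIntegral_shift_le {r : ℝ → ℝ≥0∞} {ε : ℝ} (hε : |ε| ≤ 1 / 4) :
    ∫⁻ θ in Set.Icc (-(1 / 4) : ℝ) (1 / 4), r (θ + ε) ≤
      ∫⁻ θ in Set.Icc (-(1 / 2) : ℝ) (1 / 2), r θ := by
  rw [← lintegral_indicator measurableSet_Icc, ← lintegral_indicator measurableSet_Icc,
    ← lintegral_add_right_eq_self ((Set.Icc (-(1 / 2) : ℝ) (1 / 2)).indicator r) ε]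
  refine lintegral_mono fun θ => ?_
  by_cases h : θ ∈ Set.Icc (-(1 / 4) : ℝ) (1 / 4)
  · have h' : θ + ε ∈ Set.Icc (-(1 / 2) : ℝ) (1 / 2) := by
      constructor <;> linarith [h.1, h.2, (abs_le.1 hε).1, (abs_le.1 hε).2]
    rw [Set.indicator_of_mem h, Set.indicator_of_mem h']
  · rw [Set.indicator_of_notMem h]
    exact bot_le

/-- If a risk is at least `c` on every pair of parameters at distance `2 ε`, then its average over
the uniform prior is at least `c / 4`. -/
lemma le_lintegral_of_pairs {r : ℝ → ℝ≥0∞} (hr : Measurable r) {ε c : ℝ} (hε : |ε| ≤ 1 / 4)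
    (hc : 0 ≤ c) (h : ∀ θ, |θ| ≤ 1 / 4 → ENNReal.ofReal c ≤ r (θ - ε) + r (θ + ε)) :
    ENNReal.ofReal (c / 4) ≤ ∫⁻ θ in Set.Icc (-(1 / 2) : ℝ) (1 / 2), r θ := by
  have h1 : ENNReal.ofReal c * ENNReal.ofReal (1 / 2) ≤
      2 * ∫⁻ θ in Set.Icc (-(1 / 2) : ℝ) (1 / 2), r θ := by
    calc _ = ∫⁻ _ in Set.Icc (-(1 / 4) : ℝ) (1 / 4), ENNReal.ofReal c := by
          rw [setLIntegral_const, Real.volume_Icc]; norm_num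
      _ ≤ ∫⁻ θ in Set.Icc (-(1 / 4) : ℝ) (1 / 4), (r (θ + -ε) + r (θ + ε)) :=
          setLIntegral_mono' measurableSet_Icc fun θ hθ => by
            rw [← sub_eq_add_neg]; exact h θ (abs_le.2 hθ)
      _ = (∫⁻ θ in Set.Icc (-(1 / 4) : ℝ) (1 / 4), r (θ + -ε)) +
          ∫⁻ θ in Set.Icc (-(1 / 4) : ℝ) (1 / 4), r (θ + ε) :=
          lintegral_add_left (hr.comp (measurable_add_const _)) _
      _ ≤ _ := by
          rw [two_mul]
          exact add_le_add (setLIntegral_shift_le (by rwa [abs_neg])) (setLIntegral_shift_le hε)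
  rw [← ENNReal.ofReal_mul hc, show c * (1 / 2) = 2 * (c / 4) by ring,
    ENNReal.ofReal_mul zero_le_two, show ENNReal.ofReal 2 = 2 by simp] at h1
  exact (ENNReal.mul_le_mul_iff_right (by norm_num) (by norm_num)).1 h1

/-- The excess Lagrangian of any policy accumulates logarithmically for some two-band law. -/
theorem log_le_of_sum_lagrangian_le {b Wub : ℝ} (hb : 0 < b) (hbW : b ≤ Wub)
    (π : CausalPolicy Wub) {K : ℕ} (hK : 1 ≤ K) {T : ℝ}
    (hT : ∀ θ γ : ℝ, |θ| ≤ 1 / 2 →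
      expMinLagrangian Wub (tiltedBandLaw hb θ : Measure ℝ) γ = 0 →
      ∑ i ∈ Finset.range K, ∫ ω, lagrangian γ (π.cycle ω.1 ω.2 i)
        ∂(seedDelayLaw (tiltedBandLaw hb θ)) ≤ T) :
    (b ^ 2 / 32 / (b + Wub)) ^ 2 / 512 * Real.log K ≤ T := by
  have := isProbabilityMeasure_bandLaw hb
  have hW := hb.trans_le hbW
  set κ := b ^ 2 / 32 / (b + Wub) with hκ
  have hκ0 : 0 < κ := by positivity
  choose γ₀ _ hγ₀ using fun θ =>
    (isDelayLaw_tiltedBandLaw hb θ).exists_expMinLagrangian_eq_zero hW.le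
  -- Clamping makes the chosen root antitone on the whole line, hence measurable in θ.
  set τ : ℝ → ℝ := fun θ => max (-(1 / 2)) (min (1 / 2) θ) with hτ
  have hτ_abs : ∀ θ, |τ θ| ≤ 1 / 2 := fun θ =>
    abs_le.2 ⟨le_max_left _ _, max_le (by norm_num) (min_le_left _ _)⟩
  have hτ_mono : Monotone τ := fun _ _ h => max_le_max le_rfl (min_le_min le_rfl h)
  have hτ_eq : ∀ θ, |θ| ≤ 1 / 2 → τ θ = θ := fun θ h => by
    simp only [hτ]
    rw [min_eq_right (abs_le.1 h).2, max_eq_right (abs_le.1 h).1]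
  set γ : ℝ → ℝ := fun θ => γ₀ (τ θ) with hγdef
  have hγ : ∀ θ, |θ| ≤ 1 / 2 →
      expMinLagrangian Wub (tiltedBandLaw hb θ : Measure ℝ) (γ θ) = 0 := fun θ h => by
    have := hγ₀ (τ θ)
    simp only [hγdef]
    rwa [hτ_eq θ h] at this ⊢
  have hγm : Measurable γ := by
    refine Antitone.measurable fun θ θ' h => ?_
    rcases (hτ_mono h).eq_or_lt with h' | h'
    · simp only [hγdef]; rw [h']
    · have := tiltedBandLaw_root_gap hb hbW (hτ_abs θ) (hτ_abs θ') h' (hγ₀ _) (hγ₀ _)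
      have h0 : 0 ≤ κ * (τ θ' - τ θ) := mul_nonneg hκ0.le (sub_nonneg.2 h'.le)
      exact sub_nonneg.1 (h0.trans this)
  have hs := isScore_bandScore hb
  -- With the likelihood in the integrand, the risk is an integral over a law independent of θ, and
  -- its measurability in θ follows from joint measurability.
  set G : (i : ℕ) → ℝ × (I × (Fin (i + 1) → ℝ)) → ℝ≥0∞ := fun i p =>
    ENNReal.ofReal (∏ j, (1 + p.1 * bandScore b (p.2.2 j))) *
      ((lowBand b).indicator 1 (p.2.2 (Fin.last i)) *
        ENNReal.ofReal ((π.cycleOfHistory i p.2 - γ p.1) ^ 2)) with hG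
  have hGm : ∀ i, Measurable (G i) := fun i => by
    have h1 : Measurable fun p : ℝ × (I × (Fin (i + 1) → ℝ)) =>
        ∏ j, (1 + p.1 * bandScore b (p.2.2 j)) :=
      Finset.measurable_prod _ fun j _ => (measurable_fst.mul (hs.measurable.comp
        ((measurable_pi_apply j).comp (measurable_snd.comp measurable_snd)))).const_add 1
    have h2 : Measurable fun p : ℝ × (I × (Fin (i + 1) → ℝ)) =>
        (lowBand b).indicator (1 : ℝ → ℝ≥0∞) (p.2.2 (Fin.last i)) :=
      (measurable_one.indicator (measurableSet_lowBand b)).comp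
        ((measurable_pi_apply _).comp (measurable_snd.comp measurable_snd))
    exact h1.ennreal_ofReal.mul (h2.mul ((((π.measurable_cycleOfHistory i).comp
      measurable_snd).sub (hγm.comp measurable_fst)).pow_const 2).ennreal_ofReal)
  set R : ℕ → ℝ → ℝ≥0∞ := fun i θ => ∫⁻ z, G i (θ, z)
    ∂((volume : Measure I).prod (Measure.pi fun _ : Fin (i + 1) => bandLaw b)) with hR
  have hRm : ∀ i, Measurable (R i) := fun i => (hGm i).lintegral_prod_right'
  have hReq : ∀ i θ, |θ| ≤ 1 / 2 → R i θ =
      ∫⁻ ω, (lowBand b).indicator 1 (ω.2 i) * ENNReal.ofReal ((π.cycle ω.1 ω.2 i - γ θ) ^ 2)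
        ∂(seedDelayLaw (tiltedBandLaw hb θ)) := fun i θ hθ => by
    have hF : Measurable fun z : I × (Fin (i + 1) → ℝ) =>
        (lowBand b).indicator (1 : ℝ → ℝ≥0∞) (z.2 (Fin.last i)) *
          ENNReal.ofReal ((π.cycleOfHistory i z - γ θ) ^ 2) :=
      ((measurable_one.indicator (measurableSet_lowBand b)).comp
        ((measurable_pi_apply _).comp measurable_snd)).mul
        (((π.measurable_cycleOfHistory i).sub_const _).pow_const 2).ennreal_ofReal
    have hh := (measurePreserving_history (tiltedBandLaw hb θ) (i + 1)).lintegral_comp hF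
    refine Eq.trans ?_ hh.symm
    simp only [hR]
    have hGθ : Measurable fun z => G i (θ, z) := (hGm i).comp measurable_prodMk_left
    rw [lintegral_prod _ hGθ.aemeasurable,
      lintegral_prod _ hF.aemeasurable]
    refine lintegral_congr fun u => ?_
    exact (hs.lintegral_pi_law (hF.comp measurable_prodMk_left)
      (hθ.trans (by norm_num))).symm
  have hpair : ∀ i : ℕ, ENNReal.ofReal (κ ^ 2 / 256 * ((i + 1 : ℕ) : ℝ)⁻¹) ≤
      ∫⁻ θ in Set.Icc (-(1 / 2) : ℝ) (1 / 2), R i θ := fun i => by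
    have hn : (1 : ℝ) ≤ ((i + 1 : ℕ) : ℝ) := by exact_mod_cast Nat.succ_le_succ (Nat.zero_le i)
    set n : ℝ := ((i + 1 : ℕ) : ℝ) with hndef
    -- Small enough for the two-point bound, and at most 1/4 even for n = 1, so the shifted
    -- parameters stay within the prior's range.
    set ε := 1 / (4 * Real.sqrt n) with hε
    have hsq : 1 ≤ Real.sqrt n := Real.one_le_sqrt.2 hn
    have hε0 : 0 < ε := by positivity
    have hε1 : ε ≤ 1 / 4 := one_div_le_one_div_of_le (by norm_num) (by linarith)
    have hε2 : ε ^ 2 = 1 / (16 * n) := by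
      rw [hε, div_pow, mul_pow, Real.sq_sqrt (by linarith)]; norm_num
    have := le_lintegral_of_pairs (hRm i) (ε := ε) (c := (κ * ε) ^ 2 / 4)
      (by rwa [abs_of_pos hε0]) (by positivity) fun θ hθ => by
        have hθ' := abs_le.1 hθ
        have hm : |θ - ε| ≤ 1 / 2 := abs_le.2 (by constructor <;> linarith)
        have hp : |θ + ε| ≤ 1 / 2 := abs_le.2 (by constructor <;> linarith)
        rw [hReq i _ hm, hReq i _ hp]
        refine two_point_cycle hb hbW π i hθ hε0 hε1 ?_ (hγ _ hm) (hγ _ hp)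
        rw [← hndef, hε2]
        field_simp
        norm_num
    refine le_trans (le_of_eq ?_) this
    congr 1
    rw [mul_pow, hε2]
    field_simp
    norm_num
  have hsum : ∀ θ ∈ Set.Icc (-(1 / 2) : ℝ) (1 / 2),
      ∑ i ∈ Finset.range K, R i θ ≤ ENNReal.ofReal (2 * T) := fun θ hθ => by
    have hθ' : |θ| ≤ 1 / 2 := abs_le.2 hθ
    have hnn : ∀ i, 0 ≤ ∫ ω, lagrangian (γ θ) (π.cycle ω.1 ω.2 i)
        ∂(seedDelayLaw (tiltedBandLaw hb θ)) := fun i => by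
      rw [← hγ θ hθ']
      exact π.expMinLagrangian_le_integral_cycle (isDelayLaw_tiltedBandLaw hb θ) hW.le _ i
    calc _ ≤ ∑ i ∈ Finset.range K, ENNReal.ofReal (2 * ∫ ω, lagrangian (γ θ) (π.cycle ω.1 ω.2 i)
          ∂(seedDelayLaw (tiltedBandLaw hb θ))) := Finset.sum_le_sum fun i _ => by
          rw [hReq i θ hθ']
          exact lintegral_sq_le_lagrangian hb hbW hθ' (hγ θ hθ') π i
      _ = ENNReal.ofReal (∑ i ∈ Finset.range K, 2 * ∫ ω, lagrangian (γ θ) (π.cycle ω.1 ω.2 i)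
          ∂(seedDelayLaw (tiltedBandLaw hb θ))) :=
          (ENNReal.ofReal_sum_of_nonneg fun i _ => mul_nonneg zero_le_two (hnn i)).symm
      _ ≤ _ := by
          rw [← Finset.mul_sum]
          exact ENNReal.ofReal_le_ofReal
            (mul_le_mul_of_nonneg_left (hT θ (γ θ) hθ' (hγ θ hθ')) zero_le_two)
  have hT0 : 0 ≤ T := by
    refine le_trans (Finset.sum_nonneg fun i _ => ?_) (hT 0 (γ 0) (by simp) (hγ 0 (by simp)))
    refine (hγ 0 (by simp)).symm.le.trans ?_
    exact π.expMinLagrangian_le_integral_cycle (isDelayLaw_tiltedBandLaw hb 0) hW.le _ i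
  have hmain : ENNReal.ofReal (∑ i ∈ Finset.range K, κ ^ 2 / 256 * ((i + 1 : ℕ) : ℝ)⁻¹) ≤
      ENNReal.ofReal (2 * T) := by
    rw [ENNReal.ofReal_sum_of_nonneg fun i _ => by positivity]
    calc _ ≤ ∑ i ∈ Finset.range K, ∫⁻ θ in Set.Icc (-(1 / 2) : ℝ) (1 / 2), R i θ :=
          Finset.sum_le_sum fun i _ => hpair i
      _ = ∫⁻ θ in Set.Icc (-(1 / 2) : ℝ) (1 / 2), ∑ i ∈ Finset.range K, R i θ :=
          (lintegral_finsetSum _ fun i _ => hRm i).symm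
      _ ≤ ∫⁻ _ in Set.Icc (-(1 / 2) : ℝ) (1 / 2), ENNReal.ofReal (2 * T) :=
          setLIntegral_mono' measurableSet_Icc hsum
      _ = _ := by rw [setLIntegral_const, Real.volume_Icc]; norm_num
  rw [ENNReal.ofReal_le_ofReal_iff (by positivity), ← Finset.mul_sum] at hmain
  have hharm : Real.log K ≤ ∑ i ∈ Finset.range K, ((i + 1 : ℕ) : ℝ)⁻¹ := by
    have h1 := log_add_one_le_harmonic K
    have h2 : Real.log K ≤ Real.log ((K + 1 : ℕ) : ℝ) :=
      Real.log_le_log (by exact_mod_cast hK) (by exact_mod_cast Nat.le_succ K)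
    refine (h2.trans h1).trans (le_of_eq ?_)
    simp [harmonic]
  have := mul_le_mul_of_nonneg_left hharm (by positivity : 0 ≤ κ ^ 2 / 256)
  linarith

/-! ### Lower bound for the regret. -/

lemma waiting_probability_bound_le :
    ((1 / 2 + Real.sqrt (5 / 4)) ^ (1 / 3 : ℝ) - (Real.sqrt (5 / 4) - 1 / 2) ^ (1 / 3 : ℝ)) / 2
      ≤ 1 / 4 := by
  have h1 : (1.11 : ℝ) ≤ Real.sqrt (5 / 4) := Real.le_sqrt_of_sq_le (by norm_num)
  have h2 : Real.sqrt (5 / 4) ≤ 1.12 := Real.sqrt_le_iff.2 ⟨by norm_num, by norm_num⟩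
  have hcube : ∀ x : ℝ, 0 ≤ x → (x ^ 3) ^ (1 / 3 : ℝ) = x := fun x hx => by
    rw [← Real.rpow_natCast, ← Real.rpow_mul hx]; norm_num
  have h3 : (1 / 2 + Real.sqrt (5 / 4)) ^ (1 / 3 : ℝ) ≤ 1.2 := by
    rw [← hcube 1.2 (by norm_num)]
    exact Real.rpow_le_rpow (by positivity) ((add_le_add_right h2 _).trans (by norm_num)) (by norm_num)
  have h4 : 0.8 ≤ (Real.sqrt (5 / 4) - 1 / 2) ^ (1 / 3 : ℝ) := by
    rw [← hcube 0.8 (by norm_num)]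
    exact Real.rpow_le_rpow (by norm_num) ((sub_le_sub_right h1 _).trans' (by norm_num)) (by norm_num)
  linarith

/-- The minimax lower bound `δ c log K / K` for the regret of causal policies. -/
theorem exists_minimax_regret_bound {Wub : ℝ} (hW : 0 < Wub) {B : ℝ} (hB : 0 < B) :
    ∃ c : ℝ, 0 < c ∧ ∃ K₀ : ℕ, ∀ a₀ : ℝ, 0 ≤ a₀ → ∀ δ : ℝ, 0 < δ → δ ≤ 1 / 4 →
      ∀ K : ℕ, K₀ ≤ K →
        ((δ * (c * (Real.log (K : ℝ) / (K : ℝ))) : ℝ) : EReal) ≤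
          ⨅ π : CausalPolicy Wub, ⨆ P ∈ waitingClass a₀ Wub B δ,
            ((aoiRatio a₀ π P K - optimalAoI a₀ Wub P : ℝ) : EReal) := by
  set b := min B Wub with hbdef
  have hb : 0 < b := lt_min hB hW
  have hbW : b ≤ Wub := min_le_right _ _
  have hbB : b ≤ B := min_le_left _ _
  set c₂ := (b ^ 2 / 32 / (b + Wub)) ^ 2 / 512 with hc₂
  have hc₂0 : 0 < c₂ := by positivity
  -- From K₀ on, half of the logarithmic term dominates the boundary term, which is at most b (b +
  -- Wub).
  obtain ⟨K₀, hK₀⟩ := ((Real.tendsto_log_atTop.comp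
    (tendsto_natCast_atTop_atTop (R := ℝ))).eventually_gt_atTop
      (2 * (b * (b + Wub)) / c₂)).exists_forall_of_atTop
  refine ⟨c₂ / (2 * (b + Wub)), by positivity, max K₀ 1, fun a₀ ha₀ δ hδ0 hδ K hK => ?_⟩
  have hlog := hK₀ K ((le_max_left _ _).trans hK)
  have hK1 : 1 ≤ K := (le_max_right _ _).trans hK
  simp only [Function.comp_apply] at hlog
  have hlog0 : 0 < Real.log K := hlog.trans_le' (by positivity)
  rw [div_lt_iff₀ hc₂0] at hlog
  refine le_iInf fun π => ?_
  -- The negation bounds the regret of π under all laws of the class at once, hence under every tilt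
  -- with |θ| ≤ 1/2, as the averaging argument requires.
  by_contra! hlt
  have hKpos : (0 : ℝ) < K := by exact_mod_cast hK1
  have key : c₂ * Real.log K ≤ c₂ / 2 * Real.log K + b * (b + Wub) := by
    refine log_le_of_sum_lagrangian_le hb hbW π hK1 fun θ γ hθ hγ => ?_
    set P := tiltedBandLaw hb θ with hPdef
    have hP : IsDelayLaw (P : Measure ℝ) := isDelayLaw_tiltedBandLaw hb θ
    have hmem := threshold_mem_of_root hb hbW hθ hγ
    have hPmem : P ∈ waitingClass a₀ Wub B δ := by
      refine ⟨(tiltedBandLaw_absolutelyContinuous hb θ).trans (bandLaw_absolutelyContinuous b),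
        (ae_tiltedBandLaw_mem_Icc hb θ).mono fun x hx => ⟨hx.1, hx.2.trans hbB⟩, ?_⟩
      rw [optimalThreshold_eq hP hW.le a₀ hγ]
      -- Every short delay lies below the threshold, and the low band has mass at least 1/4 for θ ≥
      -- -1/2.
      calc δ ≤ (1 + θ) / 2 := by linarith [(abs_le.1 hθ).1]
        _ = (P : Measure ℝ).real (lowBand b) :=
            (tiltedBandLaw_real hb (hθ.trans (by norm_num))).1.symm
        _ ≤ _ := measureReal_mono fun x hx => hx.2.trans hmem.1
    have hreg : aoiRatio a₀ π P K - optimalAoI a₀ Wub P <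
        δ * (c₂ / (2 * (b + Wub)) * (Real.log K / K)) := by
      rw [← EReal.coe_lt_coe_iff]
      exact lt_of_le_of_lt (le_iSup₂_of_le P hPmem le_rfl) hlt
    obtain ⟨n, rfl⟩ : ∃ n, K = n + 1 := ⟨K - 1, by omega⟩
    rw [optimalAoI_eq hP hW.le a₀ hγ, π.aoiRatio_eq hP a₀ γ n, add_sub_cancel_left] at hreg
    have hm0 := hP.mean_pos
    have hmb : ∫ x, x ∂(P : Measure ℝ) ≤ b := tiltedBandLaw_mean_le hb θ
    set m := ∫ x, x ∂(P : Measure ℝ) with hm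
    have hTpos := (mul_pos (by positivity : (0 : ℝ) < n + 1) hm0).trans_le
      (π.integral_sampleTime_pos hP a₀ n)
    have hTle : ∫ ω, π.sampleTime a₀ ω.1 ω.2 (n + 2) ∂(seedDelayLaw P) ≤
        ((n + 1 : ℕ) : ℝ) * (b + Wub) := by
      rw [π.integral_sampleTime hP a₀ (n + 1)]
      refine (Finset.sum_le_card_nsmul _ _ (b + Wub) fun i _ =>
        (π.integral_cycle_le hP i).trans (by linarith)).trans (le_of_eq ?_)
      rw [Finset.card_range, nsmul_eq_mul]
    rw [div_lt_iff₀ hTpos] at hreg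
    have hx0 : 0 ≤ c₂ / (2 * (b + Wub)) * (Real.log ((n + 1 : ℕ) : ℝ) / ((n + 1 : ℕ) : ℝ)) := by
      positivity
    have h1 : δ * (c₂ / (2 * (b + Wub)) * (Real.log ((n + 1 : ℕ) : ℝ) / ((n + 1 : ℕ) : ℝ))) *
        (∫ ω, π.sampleTime a₀ ω.1 ω.2 (n + 2) ∂(seedDelayLaw P)) ≤
        1 * (c₂ / (2 * (b + Wub)) * (Real.log ((n + 1 : ℕ) : ℝ) / ((n + 1 : ℕ) : ℝ))) *
          (((n + 1 : ℕ) : ℝ) * (b + Wub)) :=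
      -- The factor δ is simply bounded by 1 here.
      mul_le_mul (mul_le_mul_of_nonneg_right (by linarith) hx0) hTle hTpos.le (by positivity)
    have h2 : 1 * (c₂ / (2 * (b + Wub)) * (Real.log ((n + 1 : ℕ) : ℝ) / ((n + 1 : ℕ) : ℝ))) *
          (((n + 1 : ℕ) : ℝ) * (b + Wub)) = c₂ / 2 * Real.log ((n + 1 : ℕ) : ℝ) := by
      field_simp
    have hEL := π.integral_cycle_le hP n
    have h3 : m * (∫ ω, π.cycle ω.1 ω.2 n ∂(seedDelayLaw P)) ≤ b * (b + Wub) :=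
      (mul_le_mul_of_nonneg_left (hEL.trans (by linarith : _ ≤ b + Wub)) hm0.le).trans
        (mul_le_mul_of_nonneg_right hmb (by positivity))
    have h4 : 0 ≤ m * a₀ := mul_nonneg hm0.le ha₀
    rw [mul_sub] at hreg
    linarith
  linarith

theorem theorem4 (Wub : ℝ) (hW : 0 < Wub) :
    (∀ Dlb Dub Mlb Mub : ℝ, 0 < Dlb → Dlb ≤ Dub → 0 < Mlb → Mlb ≤ Mub → Dlb ^ 2 < Mub →
      ∃ c : ℝ, 0 < c ∧ ∀ a₀ : ℝ, 0 ≤ a₀ → ∀ k : ℕ, 1 ≤ k →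
        ENNReal.ofReal (c / (k : ℝ)) ≤
          ⨅ (γhat : (Fin k → ℝ) → ℝ) (_ : Measurable γhat),
            ⨆ P ∈ momentClass Dlb Dub Mlb Mub,
              ∫⁻ h, ENNReal.ofReal ((γhat h - optimalThreshold a₀ Wub P) ^ 2)
                ∂(Measure.pi (fun _ : Fin k => (P : Measure ℝ)))) ∧
    (∀ B : ℝ, 0 < B →
      ∃ c : ℝ, 0 < c ∧ ∃ K₀ : ℕ, ∀ a₀ : ℝ, 0 ≤ a₀ → ∀ δ : ℝ, 0 < δ →
        δ < ((1 / 2 + Real.sqrt (5 / 4)) ^ (1 / 3 : ℝ)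
              - (Real.sqrt (5 / 4) - 1 / 2) ^ (1 / 3 : ℝ)) / 2 →
        ∀ K : ℕ, K₀ ≤ K →
          ((δ * (c * (Real.log (K : ℝ) / (K : ℝ))) : ℝ) : EReal) ≤
            ⨅ π : CausalPolicy Wub, ⨆ P ∈ waitingClass a₀ Wub B δ,
              ((aoiRatio a₀ π P K - optimalAoI a₀ Wub P : ℝ) : EReal)) := by
  refine ⟨fun Dlb Dub Mlb Mub hD hDD _ hMM hDM =>
    exists_minimax_threshold_bound hW hD hDD hMM hDM, fun B hB => ?_⟩
  obtain ⟨c, hc, K₀, h⟩ := exists_minimax_regret_bound hW hB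
  exact ⟨c, hc, K₀, fun a₀ ha₀ δ hδ hδ' K hK =>
    h a₀ ha₀ δ hδ (hδ'.le.trans waiting_probability_bound_le) K hK⟩
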